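/- Let $\mathcal B$ and $\mathcal C$ be (not necessarily unital) $C^*$-algebras, let $E$ be a full Hilbert $\mathcal B$-module (that is, $E$ is a right Hilbert module and $\overline{\operatorname{span}}\,\langle E,E\rangle=\mathcal B$), let $F$ be a Hilbert $\mathcal C$-module, let $T\colon E\to F$ be a linear map, and put $F_T:=\overline{\operatorname{span}}\,T(E)\mathcal C$, a Hilbert $\mathcal C$-submodule of $F$ that contains $T(E)$. Write $\mathcal B^a(\cdot)$ for the $C^*$-algebra of adjointable operators on a Hilbert module, and $x^*:=\langle x,\bullet\rangle$, $E^*:=\{x^*:x\in E\}$. Homomorphisms between $C^*$-algebras are $*$-homomorphisms and need not be unital, and CP means completely positive. Then the following conditions are equivalent: 1. There exists a CP-map $\tau\colon\mathcal B\to\mathcal C$ such that $\langle T(x),T(x')\rangle=\tau(\langle x,x'\rangle)$ for all $x,x'\in E$ ($T$ is a $\tau$-map). 2. $T$ is CP-H-extendable: there exist a CP-map $\tau\colon\mathcal B\to\mathcal C$ and a homomorphism $\vartheta\colon\mathcal B^a(E)\to\mathcal B^a(F_T)$ such that the block-wise map $$\begin{pmatrix}b&y^*\\x&a\end{pmatrix}\longmapsto\begin{pmatrix}\tau(b)&T(y)^*\\T(x)&\vartheta(a)\end{pmatrix},\qquad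 \begin{pmatrix}\mathcal B&E^*\\E&\mathcal B^a(E)\end{pmatrix}\longrightarrow\begin{pmatrix}\mathcal C&F_T^*\\F_T&\mathcal B^a(F_T)\end{pmatrix},$$ between the extended linking algebras of $E$ and of $F_T$ is a CP-map. 3. $T$ is completely bounded (the entrywise inflations $T_n\colon M_n(E)\to M_n(F)$ are bounded uniformly in $n$, where $M_n(E)$ is the Hilbert $M_n(\mathcal B)$-module with $\langle X,Y\rangle_{ij}=\sum_k\langle x_{ki},y_{kj}\rangle$, and likewise for $F$), and $F_T$ can be turned into a $\mathcal B^a(E)$-$\mathcal C$ correspondence, that is, there is a nondegenerate homomorphism $\mathcal B^a(E)\to\mathcal B^a(F_T)$, written $a\mapsto(z\mapsto az)$, in such a way that $T(ax)=aT(x)$ for all $a\in\mathcal B^a(E)$ and $x\in E$. 4. $T$ is completely bounded and satisfies $$\langle T(y),T(x\langle x',y'\rangle)\rangle=\langle T(x'\langle x,y\rangle),T(y')\rangle\qquad\text{for all }x,y,x',y'\in E.$$ Moreover, there is at most one CP-map $\tau$ as in condition 1. -/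

import Mathlib

open scoped RightActions CStarAlgebra WithCStarModule
open MulOpposite

/-!
Hilbert modules. In Mathlib, `CStarModule A E` is a module over the C⋆-algebra `A` with
`A` acting by `a • x`, and with an inner product satisfying `⟪x, a • y⟫ = a * ⟪x, y⟫`, linear in the
second variable. A *right* Hilbert `B`-module (`⟪x, y b⟫ = ⟪x, y⟫ b`) is precisely a
`CStarModule` over the opposite algebra `Bᵐᵒᵖ`, the right action `x <• b` of `b : B` being `op b • x`.
-/

set_option linter.unusedSectionVars false

namespace HilbMod

section Basic

variable (B : Type*) {E : Type*} [NonUnitalCStarAlgebra B] [PartialOrder B] [StarOrderedRing B]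
  [NormedAddCommGroup E] [NormedSpace ℂ E] [SMul Bᵐᵒᵖ E] [CStarModule Bᵐᵒᵖ E]

/-- The `B`-valued inner product `⟨x, y⟩` of a right Hilbert `B`-module. -/
def rinner (x y : E) : B := unop (inner Bᵐᵒᵖ x y)

variable {B}

theorem op_rinner (x y : E) : op (rinner B x y) = inner Bᵐᵒᵖ x y := rfl

theorem star_rinner (x y : E) : star (rinner B x y) = rinner B y x := by
  apply op_injective
  rw [op_star, op_rinner, op_rinner, CStarModule.star_inner]

theorem rinner_add_right (x y z : E) :
    rinner B x (y + z) = rinner B x y + rinner B x z := by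
  simp [rinner]

theorem rinner_add_left (x y z : E) :
    rinner B (x + y) z = rinner B x z + rinner B y z := by
  simp [rinner]

theorem rinner_smul_right (c : ℂ) (x y : E) : rinner B x (c • y) = c • rinner B x y := by
  simp [rinner]

theorem rinner_smul_left (c : ℂ) (x y : E) : rinner B (c • x) y = star c • rinner B x y := by
  simp [rinner]

theorem rinner_sub_right (x y z : E) :
    rinner B x (y - z) = rinner B x y - rinner B x z := by
  simp [rinner]

theorem rinner_zero_right (x : E) : rinner B x (0 : E) = 0 := by
  simp [rinner]

theorem rinner_zero_left (x : E) : rinner B (0 : E) x = 0 := by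
  simp [rinner]

theorem rinner_act_right (x y : E) (b : B) : rinner B x (y <• b) = rinner B x y * b := by
  simp [rinner]

theorem rinner_act_left (x y : E) (b : B) : rinner B (x <• b) y = star b * rinner B x y := by
  simp [rinner]

theorem ext_rinner {x y : E} (h : ∀ z : E, rinner B z x = rinner B z y) : x = y := by
  rw [← sub_eq_zero, ← CStarModule.inner_self (A := Bᵐᵒᵖ), ← op_rinner, rinner_sub_right, h,
    sub_self, op_zero]

theorem norm_rinner_le (x y : E) : ‖rinner B x y‖ ≤ ‖x‖ * ‖y‖ := by
  have := CStarModule.norm_inner_le (A := Bᵐᵒᵖ) E (x := x) (y := y)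
  rwa [← op_rinner, norm_op] at this

theorem norm_sq_eq (x : E) : ‖x‖ ^ 2 = ‖rinner B x x‖ := by
  rw [CStarModule.norm_sq_eq Bᵐᵒᵖ, ← op_rinner, norm_op]

theorem add_act (x y : E) (b : B) : (x + y) <• b = x <• b + y <• b := by
  refine ext_rinner (B := B) fun z => ?_
  simp only [rinner_act_right, rinner_add_right, add_mul]

theorem act_add (x : E) (b c : B) : x <• (b + c) = x <• b + x <• c := by
  refine ext_rinner (B := B) fun z => ?_
  simp only [rinner_act_right, rinner_add_right, mul_add]

theorem act_zero (x : E) : x <• (0 : B) = 0 := by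
  refine ext_rinner (B := B) fun z => ?_
  rw [rinner_act_right, mul_zero, rinner_zero_right]

theorem smul_act (r : ℂ) (x : E) (b : B) : (r • x) <• b = r • (x <• b) := by
  refine ext_rinner (B := B) fun z => ?_
  simp only [rinner_act_right, rinner_smul_right, smul_mul_assoc]

theorem act_smul (r : ℂ) (x : E) (b : B) : x <• (r • b) = r • (x <• b) := by
  refine ext_rinner (B := B) fun z => ?_
  simp only [rinner_act_right, rinner_smul_right, mul_smul_comm]

theorem act_act (x : E) (b c : B) : (x <• b) <• c = x <• (b * c) := by
  refine ext_rinner (B := B) fun z => ?_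
  simp only [rinner_act_right, mul_assoc]

theorem norm_act_le (x : E) (b : B) : ‖x <• b‖ ≤ ‖x‖ * ‖b‖ := by
  refine abs_le_of_sq_le_sq' ?_ (by positivity) |>.2
  rw [norm_sq_eq (B := B), rinner_act_right, rinner_act_left]
  calc ‖star b * rinner B x x * b‖ ≤ ‖star b‖ * ‖rinner B x x‖ * ‖b‖ :=
        (norm_mul_le _ _).trans (by gcongr; exact norm_mul_le _ _)
    _ = (‖x‖ * ‖b‖) ^ 2 := by rw [norm_star, ← norm_sq_eq]; ring

variable (B E)

/-- `E` is full: the closed linear span of the inner products `⟨x, y⟩` is all of `B`. -/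
def IsFull : Prop :=
  (Submodule.span ℂ {b : B | ∃ x y : E, b = rinner B x y}).topologicalClosure = ⊤

/-! ### Adjointable operators -/

/-- The adjointable operators as a subalgebra of the bounded operators on `E`. -/
def adjointable : Subalgebra ℂ (E →L[ℂ] E) where
  carrier := {a | ∃ a' : E →L[ℂ] E, ∀ x y, rinner B (a x) y = rinner B x (a' y)}
  mul_mem' := by
    rintro a b ⟨a', ha⟩ ⟨b', hb⟩
    exact ⟨b' * a', fun x y => by
      rw [mul_apply_eq_comp, mul_apply_eq_comp, ha, hb]⟩
  add_mem' := by
    rintro a b ⟨a', ha⟩ ⟨b', hb⟩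
    exact ⟨a' + b', fun x y => by
      simp only [add_apply, rinner_add_left, rinner_add_right, ha, hb]⟩
  algebraMap_mem' r := ⟨algebraMap ℂ _ (star r), fun x y => by
    simp only [ContinuousLinearMap.algebraMap_apply, rinner_smul_left, rinner_smul_right]⟩

/-- `𝓑ᵃ(E)`, the algebra of adjointable operators on the Hilbert `B`-module `E`. -/
def Adj : Type _ := ↥(adjointable B E)

variable {B E}

namespace Adj

noncomputable instance : NormedRing (Adj B E) := inferInstanceAs (NormedRing ↥(adjointable B E))

noncomputable instance : NormedAlgebra ℂ (Adj B E) :=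
  inferInstanceAs (NormedAlgebra ℂ ↥(adjointable B E))

instance : CoeFun (Adj B E) (fun _ => E → E) := ⟨fun a => a.1⟩

theorem exists_adjoint (a : Adj B E) : ∃ a' : Adj B E, ∀ x y : E,
    rinner B (a.1 x) y = rinner B x (a'.1 y) := by
  obtain ⟨a, a', h⟩ := a
  refine ⟨⟨a', a, fun x y => ?_⟩, h⟩
  rw [← star_rinner, ← h, star_rinner]

noncomputable instance : Star (Adj B E) := ⟨fun a => (exists_adjoint a).choose⟩

theorem rinner_apply_left (a : Adj B E) (x y : E) :
    rinner B (a.1 x) y = rinner B x ((star a).1 y) := (exists_adjoint a).choose_spec x y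

theorem rinner_apply_right (a : Adj B E) (x y : E) :
    rinner B x (a.1 y) = rinner B ((star a).1 x) y := by
  rw [← star_rinner, rinner_apply_left, star_rinner]

@[ext]
theorem ext {a b : Adj B E} (h : ∀ x, a.1 x = b.1 x) : a = b :=
  Subtype.ext (ContinuousLinearMap.ext h)

theorem eq_star {a b : Adj B E} (h : ∀ x y : E, rinner B (a.1 x) y = rinner B x (b.1 y)) :
    star a = b := by
  ext y
  refine ext_rinner (B := B) fun x => ?_
  rw [← h, rinner_apply_left]

noncomputable instance : StarRing (Adj B E) where
  star_involutive a := eq_star fun x y => (rinner_apply_right a x y).symm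
  star_mul a b := eq_star fun x y => by
    change rinner B (a.1 (b.1 x)) y = rinner B x ((star b).1 ((star a).1 y))
    rw [rinner_apply_left, rinner_apply_left]
  star_add a b := eq_star fun x y => by
    change rinner B (a.1 x + b.1 x) y = rinner B x ((star a).1 y + (star b).1 y)
    rw [rinner_add_left, rinner_add_right, rinner_apply_left, rinner_apply_left]

instance : StarModule ℂ (Adj B E) where
  star_smul r a := eq_star fun x y => by
    change rinner B (r • a.1 x) y = rinner B x (star r • (star a).1 y)
    rw [rinner_smul_left, rinner_smul_right, rinner_apply_left]

theorem norm_apply_le (a : Adj B E) (x : E) : ‖a.1 x‖ ≤ ‖a‖ * ‖x‖ := a.1.le_opNorm x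

theorem norm_le {a : Adj B E} {K : ℝ} (hK : 0 ≤ K) (h : ∀ x, ‖a.1 x‖ ≤ K * ‖x‖) : ‖a‖ ≤ K :=
  ContinuousLinearMap.opNorm_le_bound _ hK h

theorem norm_mul_self_le (a : Adj B E) : ‖a‖ * ‖a‖ ≤ ‖star a * a‖ := by
  have h : ‖a‖ ≤ √‖star a * a‖ := by
    refine norm_le (Real.sqrt_nonneg _) fun x => ?_
    refine abs_le_of_sq_le_sq' ?_ (by positivity) |>.2
    rw [norm_sq_eq (B := B), rinner_apply_left, mul_pow,
      Real.sq_sqrt (norm_nonneg (star a * a))]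
    calc ‖rinner B x ((star a * a).1 x)‖ ≤ ‖x‖ * ‖(star a * a).1 x‖ := norm_rinner_le _ _
      _ ≤ ‖x‖ * (‖star a * a‖ * ‖x‖) := by gcongr; exact norm_apply_le _ _
      _ = _ := by ring
  calc ‖a‖ * ‖a‖ ≤ √‖star a * a‖ * √‖star a * a‖ := by gcongr
    _ = _ := Real.mul_self_sqrt (norm_nonneg _)

noncomputable instance : CStarRing (Adj B E) where
  norm_mul_self_le := norm_mul_self_le

theorem isClosed_adjointable [CompleteSpace E] :
    IsClosed (adjointable B E : Set (E →L[ℂ] E)) := by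
  rw [← isSeqClosed_iff_isClosed]
  intro u a hu hua
  let v : ℕ → Adj B E := fun n => ⟨u n, hu n⟩
  have hv : CauchySeq fun n => (star (v n)).1 := by
    have h1 : CauchySeq u := hua.cauchySeq
    rw [Metric.cauchySeq_iff] at h1 ⊢
    intro ε hε
    obtain ⟨N, hN⟩ := h1 ε hε
    refine ⟨N, fun m hm n hn => ?_⟩
    have h2 := hN m hm n hn
    rw [dist_eq_norm] at h2 ⊢
    have h3 : ‖star (v m - v n)‖ = ‖v m - v n‖ := norm_star (v m - v n)
    rw [star_sub] at h3
    exact lt_of_eq_of_lt h3 h2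
  obtain ⟨a', ha'⟩ := cauchySeq_tendsto_of_complete hv
  refine ⟨a', fun x y => ?_⟩
  have hc : ∀ z : E, Continuous fun w : E => rinner B z w := fun z =>
    continuous_unop.comp (CStarModule.innerSL (A := Bᵐᵒᵖ) z).continuous
  have hc' : ∀ z : E, Continuous fun w : E => rinner B w z := fun z => by
    have : (fun w : E => rinner B w z) = fun w => star (rinner B z w) := by
      ext w; rw [star_rinner]
    rw [this]; exact (hc z).star
  have e1 : Filter.Tendsto (fun n => rinner B (u n x) y) Filter.atTop (nhds (rinner B (a x) y)) :=
    ((hc' y).tendsto _).comp (((ContinuousLinearMap.apply ℂ E x).continuous.tendsto a).comp hua)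
  have e2 : Filter.Tendsto (fun n => rinner B x ((star (v n)).1 y)) Filter.atTop
      (nhds (rinner B x (a' y))) :=
    ((hc x).tendsto _).comp (((ContinuousLinearMap.apply ℂ E y).continuous.tendsto a').comp ha')
  refine tendsto_nhds_unique e1 (e2.congr fun n => ?_)
  exact (rinner_apply_left (v n) x y).symm

instance [CompleteSpace E] : CompleteSpace (Adj B E) :=
  isClosed_adjointable.completeSpace_coe

noncomputable instance [CompleteSpace E] : CStarAlgebra (Adj B E) where

theorem map_act (a : Adj B E) (x : E) (b : B) : a.1 (x <• b) = (a.1 x) <• b := by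
  refine ext_rinner (B := B) fun z => ?_
  rw [rinner_apply_right, rinner_act_right, rinner_act_right, rinner_apply_right]

end Adj


/-- The rank-one operator `x y* : z ↦ x ⟨y, z⟩`. -/
noncomputable def rankOne (x y : E) : Adj B E :=
  ⟨LinearMap.mkContinuous
    { toFun := fun z => x <• rinner B y z
      map_add' := fun z w => by rw [rinner_add_right, act_add]
      map_smul' := fun r z => by rw [rinner_smul_right, act_smul, RingHom.id_apply] }
    (‖x‖ * ‖y‖)
    (fun z => (norm_act_le x _).trans (by
      rw [mul_assoc]; gcongr; exact norm_rinner_le y z)),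
   LinearMap.mkContinuous
    { toFun := fun z => y <• rinner B x z
      map_add' := fun z w => by rw [rinner_add_right, act_add]
      map_smul' := fun r z => by rw [rinner_smul_right, act_smul, RingHom.id_apply] }
    (‖y‖ * ‖x‖)
    (fun z => (norm_act_le y _).trans (by
      rw [mul_assoc]; gcongr; exact norm_rinner_le x z)),
   fun z w => by
    change rinner B (x <• rinner B y z) w = rinner B z (y <• rinner B x w)
    rw [rinner_act_left, rinner_act_right, star_rinner]⟩

theorem rankOne_apply (x y z : E) : (rankOne x y : Adj B E).1 z = x <• rinner B y z := rfl

/-! ### The extended linking algebra -/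

variable (B E)

/-- The Hilbert `B`-module `B ⊕ E` of column vectors; the summand `B` (with its right module
structure over itself, `⟨c, d⟩ = c* d`) is realized on the type `Bᵐᵒᵖ`. -/
def Col : Type _ := C⋆ᵐᵒᵈ(Bᵐᵒᵖ, Bᵐᵒᵖ × E)

variable {B E}

noncomputable instance : NormedAddCommGroup (Col B E) :=
  inferInstanceAs (NormedAddCommGroup C⋆ᵐᵒᵈ(Bᵐᵒᵖ, Bᵐᵒᵖ × E))

noncomputable instance : NormedSpace ℂ (Col B E) :=
  inferInstanceAs (NormedSpace ℂ C⋆ᵐᵒᵈ(Bᵐᵒᵖ, Bᵐᵒᵖ × E))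

instance : SMul Bᵐᵒᵖ (Col B E) := inferInstanceAs (SMul Bᵐᵒᵖ C⋆ᵐᵒᵈ(Bᵐᵒᵖ, Bᵐᵒᵖ × E))

noncomputable instance : CStarModule Bᵐᵒᵖ (Col B E) :=
  inferInstanceAs (CStarModule Bᵐᵒᵖ C⋆ᵐᵒᵈ(Bᵐᵒᵖ, Bᵐᵒᵖ × E))

instance [CompleteSpace E] : CompleteSpace (Col B E) :=
  inferInstanceAs (CompleteSpace C⋆ᵐᵒᵈ(Bᵐᵒᵖ, Bᵐᵒᵖ × E))

/-- The column vector with entries `c : B` and `z : E`. -/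
def col (c : B) (z : E) : Col B E := (WithCStarModule.equiv _ _).symm (op c, z)

theorem exists_col (v : Col B E) : ∃ (c : B) (z : E), v = col c z := ⟨unop v.1, v.2, rfl⟩

theorem col_inj {c d : B} {z w : E} (h : col c z = col d w) : c = d ∧ z = w :=
  ⟨op_injective (congrArg Prod.fst h), congrArg Prod.snd h⟩

theorem col_add (c d : B) (z w : E) : col (c + d) (z + w) = col c z + col d w := rfl

theorem col_smul (r : ℂ) (c : B) (z : E) : col (r • c) (r • z) = r • col c z := rfl

theorem rinner_col (c d : B) (z w : E) :
    rinner B (col c z) (col d w) = star c * d + rinner B z w := rfl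

theorem norm_col_zero_right (c : B) : ‖(col c 0 : Col B E)‖ = ‖c‖ := by
  rw [← sq_eq_sq₀ (norm_nonneg _) (norm_nonneg _), norm_sq_eq (B := B), rinner_col,
    rinner_zero_right, add_zero, CStarRing.norm_star_mul_self, sq]

theorem norm_col_zero_left (z : E) : ‖(col 0 z : Col B E)‖ = ‖z‖ := by
  rw [← sq_eq_sq₀ (norm_nonneg _) (norm_nonneg _), norm_sq_eq (B := B), rinner_col,
    mul_zero, zero_add, norm_sq_eq (B := B)]

theorem norm_le_norm_col (c : B) (z : E) : ‖c‖ ≤ ‖col c z‖ ∧ ‖z‖ ≤ ‖col c z‖ := by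
  have := WithCStarModule.max_le_prod_norm (A := Bᵐᵒᵖ) (col c z)
  exact max_le_iff.mp this

theorem norm_col_le (c : B) (z : E) : ‖col c z‖ ≤ ‖c‖ + ‖z‖ :=
  WithCStarModule.prod_norm_le_norm_add (A := Bᵐᵒᵖ) (col c z)

/-- The block operator `(c, z) ↦ (b c + ⟨y, z⟩, x c + t z)` as a linear map on `B ⊕ E`. -/
noncomputable def blockLM (b : B) (x y : E) (t : Adj B E) : Col B E →ₗ[ℂ] Col B E where
  toFun v := col (b * unop v.1 + rinner B y v.2) (x <• unop v.1 + t.1 v.2)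
  map_add' v w := by
    obtain ⟨c, z, rfl⟩ := exists_col v
    obtain ⟨d, w, rfl⟩ := exists_col w
    rw [← col_add, ← col_add]
    change col (b * (c + d) + rinner B y (z + w)) (x <• (c + d) + t.1 (z + w)) =
      col ((b * c + rinner B y z) + (b * d + rinner B y w))
        ((x <• c + t.1 z) + (x <• d + t.1 w))
    rw [mul_add, rinner_add_right, act_add, map_add]
    congr 1 <;> abel
  map_smul' r v := by
    obtain ⟨c, z, rfl⟩ := exists_col v
    rw [← col_smul]
    change col (b * (r • c) + rinner B y (r • z)) (x <• (r • c) + t.1 (r • z)) =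
      r • col (b * c + rinner B y z) (x <• c + t.1 z)
    rw [← col_smul, mul_smul_comm, rinner_smul_right, act_smul, map_smul, smul_add, smul_add]

theorem blockLM_le (b : B) (x y : E) (t : Adj B E) (v : Col B E) :
    ‖blockLM b x y t v‖ ≤ ((‖b‖ + ‖y‖) + (‖x‖ + ‖t‖)) * ‖v‖ := by
  obtain ⟨c, z, rfl⟩ := exists_col v
  obtain ⟨h1, h2⟩ := norm_le_norm_col c z
  change ‖col (b * c + rinner B y z) (x <• c + t.1 z)‖ ≤ _
  refine (norm_col_le _ _).trans ?_
  rw [add_mul, add_mul, add_mul]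
  gcongr
  · refine (norm_add_le _ _).trans ?_
    gcongr
    · exact (norm_mul_le _ _).trans (by gcongr)
    · exact (norm_rinner_le _ _).trans (by gcongr)
  · refine (norm_add_le _ _).trans ?_
    gcongr
    · exact (norm_act_le _ _).trans (by gcongr)
    · exact (Adj.norm_apply_le _ _).trans (by gcongr)

/-- The block operator `(c, z) ↦ (b c + ⟨y, z⟩, x c + t z)` as a bounded map on `B ⊕ E`. -/
noncomputable def blockCLM (b : B) (x y : E) (t : Adj B E) : Col B E →L[ℂ] Col B E :=
  (blockLM b x y t).mkContinuous _ (blockLM_le b x y t)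

theorem blockCLM_apply (b : B) (x y : E) (t : Adj B E) (c : B) (z : E) :
    blockCLM b x y t (col c z) = col (b * c + rinner B y z) (x <• c + t.1 z) := rfl

theorem blockCLM_adjoint (b : B) (x y : E) (t : Adj B E) (v w : Col B E) :
    rinner B (blockCLM b x y t v) w = rinner B v (blockCLM (star b) y x (star t) w) := by
  obtain ⟨c, z, rfl⟩ := exists_col v
  obtain ⟨d, w, rfl⟩ := exists_col w
  rw [blockCLM_apply, blockCLM_apply, rinner_col, rinner_col, rinner_add_left, rinner_add_right,
    rinner_act_left, rinner_act_right, ← Adj.rinner_apply_left, star_add, star_mul, star_rinner]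
  noncomm_ring

/-- The operator on `B ⊕ E` with block matrix `[[b, y*], [x, t]]`, that is,
`(c, z) ↦ (b c + ⟨y, z⟩, x c + t z)`. -/
noncomputable def block (b : B) (x y : E) (t : Adj B E) : Adj B (Col B E) :=
  ⟨blockCLM b x y t, blockCLM (star b) y x (star t), blockCLM_adjoint b x y t⟩

theorem block_apply (b : B) (x y : E) (t : Adj B E) (c : B) (z : E) :
    (block b x y t).1 (col c z) = col (b * c + rinner B y z) (x <• c + t.1 z) := rfl

theorem ext_block {a a' : Adj B (Col B E)} (h : ∀ c z, a.1 (col c z) = a'.1 (col c z)) :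
    a = a' := by
  ext v
  obtain ⟨c, z, rfl⟩ := exists_col v
  exact h c z

theorem block_star (b : B) (x y : E) (t : Adj B E) :
    star (block b x y t) = block (star b) y x (star t) :=
  Adj.eq_star (blockCLM_adjoint b x y t)

theorem block_add (b b' : B) (x x' y y' : E) (t t' : Adj B E) :
    block (b + b') (x + x') (y + y') (t + t') = block b x y t + block b' x' y' t' := by
  refine ext_block fun c z => ?_
  change _ = (block b x y t).1 (col c z) + (block b' x' y' t').1 (col c z)
  rw [block_apply, block_apply, block_apply, ← col_add, add_mul, rinner_add_left, add_act]
  change col _ (_ + (t.1 z + t'.1 z)) = _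
  congr 1 <;> abel

theorem block_smul (r : ℂ) (b : B) (x y : E) (t : Adj B E) :
    block (r • b) (r • x) (star r • y) (r • t) = r • block b x y t := by
  refine ext_block fun c z => ?_
  change _ = r • (block b x y t).1 (col c z)
  rw [block_apply, block_apply, ← col_smul, smul_mul_assoc, rinner_smul_left, star_star, smul_act,
    smul_add, smul_add]
  rfl

theorem block_zero : block (0 : B) (0 : E) 0 0 = 0 := by
  simpa using block_smul (0 : ℂ) (0 : B) (0 : E) 0 0

theorem block_mul (b b' : B) (x x' y y' : E) (t t' : Adj B E) :
    block b x y t * block b' x' y' t' =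
      block (b * b' + rinner B y x') (x <• b' + t.1 x') (y' <• star b + (star t').1 y)
        (rankOne x y' + t * t') := by
  refine ext_block fun c z => ?_
  change (block b x y t).1 ((block b' x' y' t').1 (col c z)) = _
  rw [block_apply, block_apply, block_apply]
  change col _ _ = col _ (_ + (x <• rinner B y' z + t.1 (t'.1 z)))
  simp only [rinner_add_right, rinner_add_left, rinner_act_right, rinner_act_left, act_add,
    act_act, add_act, map_add, Adj.map_act, star_star, ← Adj.rinner_apply_right, mul_add,
    add_mul, mul_assoc]
  congr 1 <;> abel

theorem norm_block_le (b : B) (x y : E) (t : Adj B E) :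
    ‖block b x y t‖ ≤ (‖b‖ + ‖y‖) + (‖x‖ + ‖t‖) :=
  LinearMap.mkContinuous_norm_le (f := blockLM b x y t) (by positivity) (blockLM_le b x y t)

theorem norm_block_ge (b : B) (x y : E) (t : Adj B E) :
    ‖b‖ ≤ ‖block b x y t‖ ∧ ‖x‖ ≤ ‖block b x y t‖ ∧ ‖y‖ ≤ ‖block b x y t‖ ∧
      ‖t‖ ≤ ‖block b x y t‖ := by
  have hy : ∀ (b : B) (x y : E) (t : Adj B E), ‖y‖ ≤ ‖block b x y t‖ := by
    intro b x y t
    have h := Adj.norm_apply_le (block b x y t) (col 0 y)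
    rw [block_apply, norm_col_zero_left, mul_zero, zero_add] at h
    have h' := (norm_le_norm_col _ _).1.trans h
    rw [← norm_sq_eq, sq] at h'
    rcases (norm_nonneg y).eq_or_lt with h0 | h0
    · rw [← h0]; exact norm_nonneg _
    · exact le_of_mul_le_mul_right h' h0
  refine ⟨?_, ?_, hy b x y t, ?_⟩
  · have h := Adj.norm_apply_le (block b x y t) (col (star b) 0)
    rw [block_apply, norm_col_zero_right, rinner_zero_right, add_zero, norm_star] at h
    have h' := (norm_le_norm_col _ _).1.trans h
    rw [CStarRing.norm_self_mul_star] at h'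
    rcases (norm_nonneg b).eq_or_lt with h0 | h0
    · rw [← h0]; exact norm_nonneg _
    · exact le_of_mul_le_mul_right h' h0
  · have h := hy (star b) y x (star t)
    rwa [← block_star, norm_star (block b x y t)] at h
  · refine Adj.norm_le (norm_nonneg _) fun z => ?_
    have h := Adj.norm_apply_le (block b x y t) (col 0 z)
    rw [block_apply, norm_col_zero_left, act_zero, zero_add] at h
    exact (norm_le_norm_col _ _).2.trans h

variable (B E)

/-- The extended linking algebra `[[B, E*], [E, 𝓑ᵃ(E)]]` of `E`: all block operators
`[[b, y*], [x, t]]`, as a ⋆-subalgebra of `𝓑ᵃ(B ⊕ E)`. -/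
noncomputable def linking : NonUnitalStarSubalgebra ℂ (Adj B (Col B E)) where
  carrier := {a | ∃ (b : B) (x y : E) (t : Adj B E), a = block b x y t}
  zero_mem' := ⟨0, 0, 0, 0, block_zero.symm⟩
  add_mem' := by
    rintro _ _ ⟨b, x, y, t, rfl⟩ ⟨b', x', y', t', rfl⟩
    exact ⟨_, _, _, _, (block_add _ _ _ _ _ _ _ _).symm⟩
  mul_mem' := by
    rintro _ _ ⟨b, x, y, t, rfl⟩ ⟨b', x', y', t', rfl⟩
    exact ⟨_, _, _, _, block_mul _ _ _ _ _ _ _ _⟩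
  smul_mem' := by
    rintro r _ ⟨b, x, y, t, rfl⟩
    exact ⟨_, _, _, _, (block_smul _ _ _ _ _).symm⟩
  star_mem' := by
    rintro _ ⟨b, x, y, t, rfl⟩
    exact ⟨_, _, _, _, block_star _ _ _ _⟩

/-- The extended linking algebra of `E` as a type; it is a C⋆-algebra (in general without unit). -/
def Linking : Type _ := ↥(linking B E)

variable {B E}

/-- The element `[[b, y*], [x, t]]` of the extended linking algebra. -/
noncomputable def blk (b : B) (x y : E) (t : Adj B E) : Linking B E :=
  ⟨block b x y t, b, x, y, t, rfl⟩

theorem blk_surjective (a : Linking B E) :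
    ∃ (b : B) (x y : E) (t : Adj B E), a = blk b x y t := by
  obtain ⟨_, b, x, y, t, rfl⟩ := a
  exact ⟨b, x, y, t, rfl⟩

theorem blk_injective {b b' : B} {x x' y y' : E} {t t' : Adj B E}
    (h : blk b x y t = blk b' x' y' t') : b = b' ∧ x = x' ∧ y = y' ∧ t = t' := by
  have h0 : block (b - b') (x - x') (y - y') (t - t') = 0 := by
    have h1 : block b x y t = block b' x' y' t' := congrArg Subtype.val h
    have h2 := block_add (b - b') b' (x - x') x' (y - y') y' (t - t') t'
    rw [sub_add_cancel, sub_add_cancel, sub_add_cancel, sub_add_cancel, h1] at h2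
    exact left_eq_add.mp (by rw [add_comm] at h2; exact h2)
  have h3 := norm_block_ge (b - b') (x - x') (y - y') (t - t')
  rw [h0, norm_zero (E := Adj B (Col B E))] at h3
  obtain ⟨h4, h5, h6, h7⟩ := h3
  exact ⟨sub_eq_zero.mp (norm_le_zero_iff.mp h4), sub_eq_zero.mp (norm_le_zero_iff.mp h5),
    sub_eq_zero.mp (norm_le_zero_iff.mp h6),
    sub_eq_zero.mp (norm_le_zero_iff (E := Adj B E).mp h7)⟩

instance isClosed_linking [CompleteSpace E] :
    IsClosed (linking B E : Set (Adj B (Col B E))) := by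
  let φ : B × E × E × Adj B E →+ Adj B (Col B E) :=
    { toFun := fun p => block p.1 p.2.1 p.2.2.1 p.2.2.2
      map_zero' := block_zero
      map_add' := fun p q => block_add _ _ _ _ _ _ _ _ }
  have hφ : AntilipschitzWith 1 φ := by
    refine AddMonoidHomClass.antilipschitz_of_bound φ fun p => ?_
    obtain ⟨h1, h2, h3, h4⟩ := norm_block_ge p.1 p.2.1 p.2.2.1 p.2.2.2
    rw [NNReal.coe_one, one_mul]
    exact max_le h1 (max_le h2 (max_le h3 h4))
  have hφ' : Continuous φ := by
    refine AddMonoidHomClass.continuous_of_bound φ 4 fun p => ?_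
    have h : ‖block p.1 p.2.1 p.2.2.1 p.2.2.2‖ ≤ (‖p.1‖ + ‖p.2.2.1‖) + (‖p.2.1‖ + ‖p.2.2.2‖) :=
      norm_block_le _ _ _ _
    refine h.trans ?_
    have h1 : ‖p.1‖ ≤ ‖p‖ := norm_fst_le p
    have h2 : ‖p.2‖ ≤ ‖p‖ := norm_snd_le p
    have h3 : ‖p.2.1‖ ≤ ‖p.2‖ := norm_fst_le p.2
    have h4 : ‖p.2.2‖ ≤ ‖p.2‖ := norm_snd_le p.2
    have h5 : ‖p.2.2.1‖ ≤ ‖p.2.2‖ := norm_fst_le p.2.2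
    have h6 : ‖p.2.2.2‖ ≤ ‖p.2.2‖ := norm_snd_le p.2.2
    linarith
  have h := hφ.isClosed_range
    (uniformContinuous_addMonoidHom_of_continuous hφ')
  have h' : Set.range φ = (linking B E : Set (Adj B (Col B E))) := by
    ext a
    constructor
    · rintro ⟨p, rfl⟩
      exact ⟨_, _, _, _, rfl⟩
    · rintro ⟨b, x, y, t, rfl⟩
      exact ⟨(b, x, y, t), rfl⟩
  rwa [h'] at h

noncomputable instance [CompleteSpace E] : NonUnitalCStarAlgebra (Linking B E) :=
  inferInstanceAs (NonUnitalCStarAlgebra ↥(linking B E))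

/-- The order of the C⋆-algebra `Linking B E`: `a ≤ b` iff `b - a` is selfadjoint with
nonnegative spectrum. -/
noncomputable instance [CompleteSpace E] : PartialOrder (Linking B E) :=
  CStarAlgebra.spectralOrder _

instance [CompleteSpace E] : StarOrderedRing (Linking B E) :=
  CStarAlgebra.spectralOrderedRing _

theorem mem_closure_act (y : E) : y ∈ closure {z : E | ∃ b : B, z = y <• b} := by
  have hl := CStarAlgebra.increasingApproximateUnit B
  rw [Metric.mem_closure_iff]
  intro ε hε
  have h1 : Filter.Tendsto (fun u : B => ‖rinner B y y * u - rinner B y y‖)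
      (CStarAlgebra.approximateUnit B) (nhds 0) :=
    tendsto_iff_norm_sub_tendsto_zero.mp (hl.tendsto_mul_left (rinner B y y))
  have h2 : ∀ᶠ u in CStarAlgebra.approximateUnit B,
      ‖rinner B y y * u - rinner B y y‖ < ε ^ 2 / 2 :=
    h1.eventually (gt_mem_nhds (by positivity))
  obtain ⟨u, hu1, hu2, hu3⟩ := (h2.and (hl.eventually_norm.and hl.eventually_star_eq)).exists
  refine ⟨y <• u, ⟨u, rfl⟩, ?_⟩
  rw [dist_comm, dist_eq_norm]
  refine lt_of_pow_lt_pow_left₀ 2 hε.le ?_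
  have h3 : rinner B (y <• u - y) (y <• u - y) =
      u * (rinner B y y * u - rinner B y y) - (rinner B y y * u - rinner B y y) := by
    rw [rinner_sub_right, rinner_act_right, ← star_rinner y, rinner_sub_right, rinner_act_right,
      star_sub, star_mul, star_rinner, hu3]
    noncomm_ring
  rw [norm_sq_eq (B := B), h3]
  calc ‖u * (rinner B y y * u - rinner B y y) - (rinner B y y * u - rinner B y y)‖
      ≤ ‖u‖ * ‖rinner B y y * u - rinner B y y‖ + ‖rinner B y y * u - rinner B y y‖ :=
        (norm_sub_le _ _).trans (by gcongr; exact norm_mul_le _ _)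
    _ ≤ 1 * ‖rinner B y y * u - rinner B y y‖ + ‖rinner B y y * u - rinner B y y‖ := by gcongr
    _ < ε ^ 2 := by linarith

end Basic

/-! ### The submodule generated by the range of a map -/

section Generated

variable (C : Type*) {E F : Type*} [NonUnitalCStarAlgebra C] [PartialOrder C] [StarOrderedRing C]
  [AddCommGroup E] [Module ℂ E]
  [NormedAddCommGroup F] [NormedSpace ℂ F] [SMul Cᵐᵒᵖ F] [CStarModule Cᵐᵒᵖ F]

/-- The closed linear span of `T(E) C`, as a subspace of `F`. -/
def genSubmodule (T : E →ₗ[ℂ] F) : Submodule ℂ F :=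
  (Submodule.span ℂ {y : F | ∃ (x : E) (c : C), y = T x <• c}).topologicalClosure

variable {C}

theorem act_mem_genSubmodule (T : E →ₗ[ℂ] F) {y : F} (hy : y ∈ genSubmodule C T) (c : C) :
    y <• c ∈ genSubmodule C T := by
  let R : F →L[ℂ] F := LinearMap.mkContinuous
    { toFun := fun x => x <• c
      map_add' := fun x y => add_act x y c
      map_smul' := fun r x => smul_act r x c } ‖c‖
    (fun x => by rw [mul_comm]; exact norm_act_le x c)
  have h : Set.MapsTo R (Submodule.span ℂ {y : F | ∃ (x : E) (c : C), y = T x <• c})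
      (Submodule.span ℂ {y : F | ∃ (x : E) (c : C), y = T x <• c}) := by
    intro z hz
    induction hz using Submodule.span_induction with
    | mem z hz =>
      obtain ⟨x, d, rfl⟩ := hz
      exact Submodule.subset_span ⟨x, d * c, act_act (T x) d c⟩
    | zero => rw [map_zero]; exact Submodule.zero_mem _
    | add z w _ _ hz hw => rw [map_add]; exact Submodule.add_mem _ hz hw
    | smul r z _ hz => rw [map_smul]; exact Submodule.smul_mem _ r hz
  exact h.closure R.continuous hy

theorem apply_mem_genSubmodule (T : E →ₗ[ℂ] F) (x : E) : T x ∈ genSubmodule C T := by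
  refine closure_mono ?_ (mem_closure_act (B := C) (T x))
  rintro _ ⟨c, rfl⟩
  exact Submodule.subset_span ⟨x, c, rfl⟩

variable (C)

/-- The Hilbert `C`-submodule `F_T` of `F` generated by `T(E)`, with the restricted operations. -/
def Gen (T : E →ₗ[ℂ] F) : Type _ := ↥(genSubmodule C T)

variable {C}

namespace Gen

variable (T : E →ₗ[ℂ] F)

noncomputable instance : NormedAddCommGroup (Gen C T) :=
  inferInstanceAs (NormedAddCommGroup ↥(genSubmodule C T))

noncomputable instance : NormedSpace ℂ (Gen C T) := inferInstanceAs (NormedSpace ℂ ↥(genSubmodule C T))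

instance [CompleteSpace F] : CompleteSpace (Gen C T) :=
  (Submodule.isClosed_topologicalClosure _).completeSpace_coe

instance : SMul Cᵐᵒᵖ (Gen C T) :=
  ⟨fun c y => ⟨c • y.1, act_mem_genSubmodule T y.2 (unop c)⟩⟩

noncomputable instance : CStarModule Cᵐᵒᵖ (Gen C T) where
  inner x y := inner Cᵐᵒᵖ x.1 y.1
  inner_add_right := CStarModule.inner_add_right
  inner_self_nonneg := CStarModule.inner_self_nonneg
  inner_self {x} := CStarModule.inner_self.trans
    (Subtype.ext_iff (a1 := x) (a2 := (0 : ↥(genSubmodule C T)))).symm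
  inner_op_smul_right := CStarModule.inner_op_smul_right
  inner_smul_right_complex := CStarModule.inner_smul_right_complex
  star_inner x y := CStarModule.star_inner x.1 y.1
  norm_eq_sqrt_norm_inner_self x := CStarModule.norm_eq_sqrt_norm_inner_self x.1

variable (C)

/-- `T x` as an element of `F_T`. -/
def mk (x : E) : Gen C T := ⟨T x, apply_mem_genSubmodule T x⟩

end Gen

end Generated

/-! ### The notions in the theorem -/

section Notions

variable (B C : Type*) {E F : Type*}
  [NonUnitalCStarAlgebra B] [PartialOrder B] [StarOrderedRing B]
  [NonUnitalCStarAlgebra C] [PartialOrder C] [StarOrderedRing C]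
  [NormedAddCommGroup E] [NormedSpace ℂ E] [SMul Bᵐᵒᵖ E] [CStarModule Bᵐᵒᵖ E]
  [NormedAddCommGroup F] [NormedSpace ℂ F] [SMul Cᵐᵒᵖ F] [CStarModule Cᵐᵒᵖ F]

variable {B C} in
/-- `T` is a `τ`-map: `⟨T x, T x'⟩ = τ ⟨x, x'⟩`. -/
def IsTauMap (τ : B →CP C) (T : E →ₗ[ℂ] F) : Prop :=
  ∀ x x' : E, rinner C (T x) (T x') = τ (rinner B x x')

/-- The norm of the Hilbert `M_n(B)`-module `M_n(E)`, whose inner product is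
`⟨X, Y⟩ i j = ∑ k, ⟨X k i, Y k j⟩`. -/
noncomputable def matrixNorm {n : ℕ} (X : Matrix (Fin n) (Fin n) E) : ℝ :=
  √‖(CStarMatrix.ofMatrix fun i j => ∑ k, rinner B (X k i) (X k j) :
      CStarMatrix (Fin n) (Fin n) B)‖

/-- `T` is completely bounded: the inflations `T_n : M_n(E) → M_n(F)`, acting entrywise, are
bounded uniformly in `n`. -/
def IsCompletelyBounded (T : E →ₗ[ℂ] F) : Prop :=
  ∃ K : ℝ, ∀ (n : ℕ) (X : Matrix (Fin n) (Fin n) E),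
    matrixNorm C (X.map T) ≤ K * matrixNorm B X

/-- `T` is CP-H-extendable: there is a completely positive map
`[[τ, T*], [T, ϑ]] : [[B, E*], [E, 𝓑ᵃ(E)]] → [[C, F_T*], [F_T, 𝓑ᵃ(F_T)]]` acting blockwise,
with `T*(y*) = T(y)*`, whose corner `ϑ` is a homomorphism of (⋆-)algebras, not assumed unital. -/
def IsCPHExtendable [CompleteSpace E] [CompleteSpace F] (T : E →ₗ[ℂ] F) : Prop :=
  ∃ (S : Linking B E →CP Linking C (Gen C T)) (τ : B →CP C)
    (ϑ : Adj B E →⋆ₙₐ[ℂ] Adj C (Gen C T)),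
    ∀ (b : B) (x y : E) (t : Adj B E),
      S (blk b x y t) = blk (τ b) (Gen.mk C T x) (Gen.mk C T y) (ϑ t)

/-- The structure of an `A`-`C` correspondence on the Hilbert `C`-module `F`: a nondegenerate left
action of the C⋆-algebra `A` by adjointable operators on `F`. -/
structure CorrespondenceStructure (A C F : Type*) [NonUnitalCStarAlgebra A]
    [NonUnitalCStarAlgebra C] [PartialOrder C] [StarOrderedRing C]
    [NormedAddCommGroup F] [NormedSpace ℂ F] [SMul Cᵐᵒᵖ F] [CStarModule Cᵐᵒᵖ F] where
  /-- the left action -/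
  act : A →⋆ₙₐ[ℂ] Adj C F
  nondegenerate :
    (Submodule.span ℂ {y : F | ∃ (a : A) (z : F), y = act a z}).topologicalClosure = ⊤

/-- `F_T` can be turned into a `𝓑ᵃ(E)`-`C` correspondence such that `T` is left
`𝓑ᵃ(E)`-linear. -/
def IsLeftLinearizable [CompleteSpace E] (T : E →ₗ[ℂ] F) : Prop :=
  ∃ L : CorrespondenceStructure (Adj B E) C (Gen C T),
    ∀ (a : Adj B E) (x : E), Gen.mk C T (a x) = L.act a (Gen.mk C T x)

/-- The quaternary condition `⟨T y, T(x ⟨x', y'⟩)⟩ = ⟨T(x' ⟨x, y⟩), T y'⟩`. -/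
def IsQuaternary (T : E →ₗ[ℂ] F) : Prop :=
  ∀ x y x' y' : E,
    rinner C (T y) (T (x <• rinner B x' y')) = rinner C (T (x' <• rinner B x y)) (T y')

end Notions

end HilbMod

namespace HilbMod

open Filter Topology

/-! ### Inner products and the right action: additivity, continuity, Cauchy–Schwarz -/

section Basic

variable {B : Type*} {E : Type*} [NonUnitalCStarAlgebra B] [PartialOrder B] [StarOrderedRing B]
  [NormedAddCommGroup E] [NormedSpace ℂ E] [SMul Bᵐᵒᵖ E] [CStarModule Bᵐᵒᵖ E]

/-! Everything passes through two properties of `T`: `IsAdjointCompatible`, by which adjointable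
operators on `E` move across `⟨T x, T y⟩`, and `IsColumnBounded`, complete boundedness tested on
columns only. Each of the four conditions yields both, and `exists_isTauMap` recovers `τ` from them.

The main tool is a net of finite columns `w` in `E` whose squared lengths `q = ∑ ⟨w_j, w_j⟩` satisfy
`‖q‖ ≤ 1` and `x q → x` on `E` (`exists_column_net`). The quaternary identity turns `∑ ⟨T x, T (y
q)⟩` into `∑ ⟨T (w_j β*), T w_j⟩` with `β = ∑ ⟨x, y⟩`. Cauchy–Schwarz and the column bound control
this by `K ‖β‖`, so `⟨x, y⟩ ↦ ⟨T x, T y⟩` extends continuously to `B` by fullness. The extension is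
CP because `τ(a_k* q a_l)` is a sum of Gram matrices of the vectors `T (w_j a_k)`. Uniqueness is
density together with continuity of CP maps.

Conversely, let `T` be a `τ`-map. Complete boundedness holds because `τ` is uniformly bounded on
positive matrices, and `ϑ(a) (T x c) = T (a x) c` defines a unital representation on `F_T`. The
block map `S` satisfies `S(r* r') = S(r)* S(r')` on second rows; as `diag(q, 1)` is a sum of
elements `r* r` and acts as a left approximate unit, `S` is CP.

Given a CP-H-extension, its corner `τ` is not related to `T` beforehand. Positivity of the block map
forces `ϑ(a) T x = T (a x)` by a variational argument, and then `⟨T x, T x⟩ ≤ τ ⟨x, x⟩` in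
compressed form, hence a column bound. The map of condition 1 is then constructed afresh. -/

theorem rinner_self_nonneg (x : E) : 0 ≤ rinner B x x :=
  MulOpposite.unop_nonneg.mpr CStarModule.inner_self_nonneg

theorem rinner_self_eq_zero {x : E} (h : rinner B x x = 0) : x = 0 := by
  rw [← CStarModule.inner_self (A := Bᵐᵒᵖ), ← op_rinner, h, op_zero]

theorem rinner_neg_right (x y : E) : rinner B x (-y) = -rinner B x y := by
  simp [rinner]

theorem rinner_neg_left (x y : E) : rinner B (-x) y = -rinner B x y := by
  simp [rinner]

theorem rinner_sub_left (x y z : E) : rinner B (x - y) z = rinner B x z - rinner B y z := by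
  simp [rinner]

theorem rinner_sum_right {ι : Type*} (s : Finset ι) (x : E) (y : ι → E) :
    rinner B x (∑ i ∈ s, y i) = ∑ i ∈ s, rinner B x (y i) := by
  simp [rinner]

theorem rinner_sum_left {ι : Type*} (s : Finset ι) (x : ι → E) (y : E) :
    rinner B (∑ i ∈ s, x i) y = ∑ i ∈ s, rinner B (x i) y := by
  simp [rinner]

variable (B) in
theorem continuous_rinner : Continuous fun p : E × E => rinner B p.1 p.2 :=
  continuous_unop.comp CStarModule.continuous_inner

theorem _root_.Filter.Tendsto.rinner {ι : Type*} {l : Filter ι} {f g : ι → E} {x y : E}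
    (hf : Tendsto f l (𝓝 x)) (hg : Tendsto g l (𝓝 y)) :
    Tendsto (fun i => HilbMod.rinner B (f i) (g i)) l (𝓝 (HilbMod.rinner B x y)) :=
  ((continuous_rinner B).tendsto (x, y)).comp (hf.prodMk_nhds hg)

variable (B E) in
/-- The right action `(x, b) ↦ x b` as a bilinear map. -/
def actₗ : E →ₗ[ℂ] B →ₗ[ℂ] E :=
  LinearMap.mk₂ ℂ (fun x b => x <• b) add_act smul_act act_add act_smul

theorem act_sum {ι : Type*} (s : Finset ι) (x : E) (b : ι → B) :
    x <• (∑ i ∈ s, b i) = ∑ i ∈ s, x <• b i :=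
  map_sum (actₗ B E x) b s

theorem zero_act (b : B) : (0 : E) <• b = 0 :=
  map_zero ((actₗ B E).flip b)

theorem neg_act (x : E) (b : B) : (-x) <• b = -(x <• b) :=
  map_neg ((actₗ B E).flip b) x

/-- The Cauchy–Schwarz inequality for the inner product of columns. -/
theorem norm_sum_rinner_le {n : ℕ} (x y : Fin n → E) :
    ‖∑ i, rinner B (x i) (y i)‖ ≤
      √‖∑ i, rinner B (x i) (x i)‖ * √‖∑ i, rinner B (y i) (y i)‖ := by
  have h := CStarModule.norm_inner_le (A := Bᵐᵒᵖ) (C⋆ᵐᵒᵈ(Bᵐᵒᵖ, Fin n → E))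
    (x := (WithCStarModule.equiv _ _).symm x) (y := (WithCStarModule.equiv _ _).symm y)
  have e (u v : Fin n → E) : inner Bᵐᵒᵖ
      ((WithCStarModule.equiv Bᵐᵒᵖ (Fin n → E)).symm u)
      ((WithCStarModule.equiv Bᵐᵒᵖ (Fin n → E)).symm v) = op (∑ i, rinner B (u i) (v i)) := by
    rw [Finset.op_sum]; rfl
  rwa [CStarModule.norm_eq_sqrt_norm_inner_self (A := Bᵐᵒᵖ) ((WithCStarModule.equiv _ _).symm x),
    CStarModule.norm_eq_sqrt_norm_inner_self (A := Bᵐᵒᵖ) ((WithCStarModule.equiv _ _).symm y),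
    e, e, e, norm_op, norm_op, norm_op] at h

end Basic

/-! ### Approximate units made of columns of the module -/

section QuasiUnit

variable {B : Type*} {E : Type*} [NonUnitalCStarAlgebra B] [PartialOrder B] [StarOrderedRing B]

/-- Functional calculus: with `q = g h g`, the second estimate is `‖(1 - q) h (1 - q)‖ ≤ ε`,
multiplied out because `B` need not have a unit. The form `g h g` matters since it will be the
squared length of a column. -/
theorem exists_quasi_unit {h : B} (hh : 0 ≤ h) {ε : ℝ} (hε : 0 < ε) :
    ∃ g : B, star g = g ∧ ‖g * h * g‖ ≤ 1 ∧
      ‖h - g * h * g * h - h * (g * h * g) + g * h * g * h * (g * h * g)‖ ≤ ε := by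
  have hsa : IsSelfAdjoint h := hh.isSelfAdjoint
  -- On `t ≥ 0` this makes `f(t) t f(t) = (t / (t + ε))²`; the absolute value keeps `f` continuous
  -- on all of `ℝ`.
  obtain ⟨f, hf_def⟩ : ∃ f : ℝ → ℝ, f = fun t => √t / (|t| + ε) := ⟨_, rfl⟩
  have hf : Continuous f :=
    hf_def ▸ Real.continuous_sqrt.div (by fun_prop) fun t => by positivity
  have hf0 : f 0 = 0 := by simp [hf_def]
  have hq : ∀ t ∈ quasispectrum ℝ h, 0 ≤ t := quasispectrum_nonneg_of_nonneg h hh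
  have e1 : cfcₙ (fun t => f t * t * f t) h = cfcₙ f h * h * cfcₙ f h := by
    rw [cfcₙ_mul (fun t => f t * t) f h, cfcₙ_mul f (fun t => t) h, cfcₙ_id' ℝ h]
  obtain ⟨F, hF_def⟩ : ∃ F : ℝ → ℝ, F = fun t => f t * t * f t := ⟨_, rfl⟩
  have hF : Continuous F := hF_def ▸ (by fun_prop)
  have hF0 : F 0 = 0 := by simp [hF_def]
  have e2 : cfcₙ (fun t => t - F t * t - t * F t + F t * t * F t) h =
      h - cfcₙ F h * h - h * cfcₙ F h + cfcₙ F h * h * cfcₙ F h := by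
    rw [cfcₙ_add (fun t => t - F t * t - t * F t) (fun t => F t * t * F t) h,
      cfcₙ_sub (fun t => t - F t * t) (fun t => t * F t) h,
      cfcₙ_sub (fun t => t) (fun t => F t * t) h, cfcₙ_mul (fun t => F t * t) F h,
      cfcₙ_mul F (fun t => t) h, cfcₙ_mul (fun t => t) F h, cfcₙ_id' ℝ h]
  have hFt : ∀ t, 0 ≤ t → F t = (t / (t + ε)) ^ 2 := fun t ht => by
    have := Real.mul_self_sqrt ht
    simp only [hF_def, hf_def, abs_of_nonneg ht]
    field_simp
    linear_combination t * this
  refine ⟨cfcₙ f h, (cfcₙ_predicate f h).star_eq, ?_, ?_⟩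
  · rw [← e1, ← hF_def]
    refine norm_cfcₙ_le fun t ht => ?_
    have ht := hq t ht
    rw [hFt t ht, Real.norm_of_nonneg (by positivity)]
    exact pow_le_one₀ (by positivity) ((div_le_one (by positivity)).mpr (by linarith))
  · rw [← e1, ← hF_def, ← e2]
    refine norm_cfcₙ_le fun t ht => ?_
    have ht := hq t ht
    have e3 : t - F t * t - t * F t + F t * t * F t = t * (1 - F t) ^ 2 := by ring
    have e4 : t * (1 - F t) ^ 2 = ε ^ 2 * t * (2 * t + ε) ^ 2 / (t + ε) ^ 4 := by
      rw [hFt t ht]; field_simp; ring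
    rw [e3, Real.norm_of_nonneg (by positivity), e4, div_le_iff₀ (by positivity)]
    -- After division by `ε`, the right side minus the left is `t⁴ + 2 ε² t² + 3 ε³ t + ε⁴`.
    nlinarith [mul_nonneg hε.le (pow_nonneg ht 4), mul_nonneg (pow_nonneg hε.le 2) (pow_nonneg ht 3),
      mul_nonneg (pow_nonneg hε.le 3) (pow_nonneg ht 2), mul_nonneg (pow_nonneg hε.le 4) ht,
      pow_nonneg hε.le 5]

end QuasiUnit

section ApproximateUnit

variable {B : Type*} {E : Type*} [NonUnitalCStarAlgebra B] [PartialOrder B] [StarOrderedRing B]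
  [NormedAddCommGroup E] [NormedSpace ℂ E] [SMul Bᵐᵒᵖ E] [CStarModule Bᵐᵒᵖ E]

-- Take `h = ∑ ⟨x, x⟩` over `s` and the column with entries `x g`: its squared length is `q = g h
-- g`. Since `⟨v, v⟩ ≤ h`, the error `(1 - q) ⟨v, v⟩ (1 - q)` is dominated by `(1 - q) h (1 - q)`.
variable (B) in
theorem exists_column_approx (s : Finset E) {ε : ℝ} (hε : 0 < ε) :
    ∃ w : Fin s.card → E, ‖∑ j, rinner B (w j) (w j)‖ ≤ 1 ∧
      ∀ v ∈ s, ‖v <• (∑ j, rinner B (w j) (w j)) - v‖ ^ 2 ≤ ε := by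
  set h : B := ∑ x ∈ s, rinner B x x with hdef
  have hh : 0 ≤ h := Finset.sum_nonneg fun x _ => rinner_self_nonneg x
  obtain ⟨g, hg, h1, h2⟩ := exists_quasi_unit hh hε
  have e : ∑ j, rinner B ((s.equivFin.symm j : E) <• g) ((s.equivFin.symm j : E) <• g) =
      g * h * g := by
    simp only [rinner_act_left, rinner_act_right, hg]
    rw [Equiv.sum_comp s.equivFin.symm (fun x => g * rinner B (x : E) (x : E) * g),
      Finset.sum_coe_sort s (fun x => g * rinner B x x * g), ← Finset.sum_mul,
      ← Finset.mul_sum]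
  refine ⟨fun j => (s.equivFin.symm j : E) <• g, e ▸ h1, fun v hv => ?_⟩
  rw [e]
  set q := g * h * g
  have hq : star q = q := by
    simp only [q, star_mul, hg, hh.isSelfAdjoint.star_eq, mul_assoc]
  rw [norm_sq_eq (B := B)]
  refine le_trans (CStarAlgebra.norm_le_norm_of_nonneg_of_le (rinner_self_nonneg _) ?_) h2
  have hle : rinner B v v ≤ h := Finset.single_le_sum (f := fun x : E => rinner B x x)
    (fun x _ => rinner_self_nonneg x) hv
  have hpos : 0 ≤ h - rinner B v v := sub_nonneg.mpr hle
  obtain ⟨r, hr⟩ := CStarAlgebra.nonneg_iff_eq_star_mul_self.mp hpos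
  -- With `h - ⟨v, v⟩ = r* r`, the gap in the desired inequality is exactly `(r - r q)* (r - r q)`.
  have hr' := star_mul_self_nonneg (r - r * q)
  rw [← sub_nonneg]
  convert hr' using 1
  have : h = rinner B v v + star r * r := by rw [← hr]; abel
  simp only [star_sub, star_mul, hq, rinner_sub_left, rinner_sub_right, rinner_act_left,
    rinner_act_right]
  rw [this]
  noncomm_ring

variable (B E) in
/-- A net of columns in `E` whose squared lengths form a contractive right approximate unit. -/
theorem exists_column_net : ∃ w : (i : Finset E × ℕ) → Fin i.1.card → E,
    (∀ i, ‖∑ j, rinner B (w i j) (w i j)‖ ≤ 1) ∧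
      ∀ v : E, Tendsto (fun i => v <• (∑ j, rinner B (w i j) (w i j))) atTop (𝓝 v) := by
  choose w hw1 hw2 using fun i : Finset E × ℕ =>
    exists_column_approx B i.1 (ε := (1 / ((i.2 : ℝ) + 1)) ^ 2) (by positivity)
  refine ⟨w, hw1, fun v => ?_⟩
  rw [tendsto_iff_norm_sub_tendsto_zero]
  have h0 : Tendsto (fun i : Finset E × ℕ => 1 / ((i.2 : ℝ) + 1)) atTop (𝓝 0) :=
    (tendsto_one_div_add_atTop_nhds_zero_nat (𝕜 := ℝ)).comp
      (prod_atTop_atTop_eq (α := Finset E) (β := ℕ) ▸ tendsto_snd)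
  refine squeeze_zero' (Eventually.of_forall fun i => norm_nonneg _) ?_ h0
  filter_upwards [eventually_ge_atTop (({v} : Finset E), 0)] with i hi
  refine abs_le_of_sq_le_sq' (hw2 i v ?_) (by positivity) |>.2
  exact hi.1 (Finset.mem_singleton_self v)

/-- Clear for `b = ⟨x, y⟩`, since `⟨x, y⟩ q = ⟨x, y q⟩`; the bound `‖q i‖ ≤ 1` carries it from the
span to its closure. -/
theorem tendsto_of_isFull (hE : IsFull B E) {ι : Type*} {l : Filter ι} {q : ι → B}
    (hq : ∀ i, ‖q i‖ ≤ 1) (h : ∀ v : E, Tendsto (fun i => v <• q i) l (𝓝 v)) (b : B) :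
    Tendsto (fun i => b * q i) l (𝓝 b) := by
  have hb : b ∈ closure
      (Submodule.span ℂ {b : B | ∃ x y : E, b = rinner B x y} : Set B) := by
    have : b ∈ (⊤ : Submodule ℂ B) := trivial
    rw [← hE] at this
    exact this
  rw [Metric.tendsto_nhds]
  intro ε hε
  obtain ⟨c, hc, hbc⟩ := Metric.mem_closure_iff.mp hb (ε / 3) (by positivity)
  have hcq : Tendsto (fun i => c * q i) l (𝓝 c) := by
    clear hbc
    induction hc using Submodule.span_induction with
    | mem c hc =>
      obtain ⟨x, y, rfl⟩ := hc
      simpa only [rinner_act_right] using (tendsto_const_nhds (x := x)).rinner (B := B) (h y)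
    | zero => simpa only [zero_mul] using tendsto_const_nhds
    | add c d _ _ hc hd => simpa only [add_mul] using hc.add hd
    | smul r c _ hc => simpa only [smul_mul_assoc] using hc.const_smul r
  filter_upwards [Metric.tendsto_nhds.mp hcq (ε / 3) (by positivity)] with i hi
  rw [dist_eq_norm] at hi hbc ⊢
  have e : b * q i - b = (b - c) * q i + (c * q i - c) - (b - c) := by noncomm_ring
  calc ‖b * q i - b‖ ≤ ‖b - c‖ * ‖q i‖ + ‖c * q i - c‖ + ‖b - c‖ := by
        rw [e]
        refine (norm_sub_le _ _).trans ?_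
        gcongr
        exact (norm_add_le _ _).trans (by gcongr; exact norm_mul_le _ _)
    _ ≤ ‖b - c‖ * 1 + ‖c * q i - c‖ + ‖b - c‖ := by gcongr; exact hq i
    _ < ε := by linarith

end ApproximateUnit

/-! ### Positive elements, matrices and Gram matrices -/

section Positivity

variable {A : Type*} [NonUnitalCStarAlgebra A] [PartialOrder A] [StarOrderedRing A]

theorem exists_eq_star_mul_self {a : A} (ha : 0 ≤ a) : ∃ b : A, a = star b * b :=
  CStarAlgebra.nonneg_iff_eq_star_mul_self.mp ha

theorem star_conj_le_norm_smul {a b : A} (hb : 0 ≤ b) :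
    star a * b * a ≤ (‖b‖ : ℂ) • (star a * a) := by
  have := CStarAlgebra.star_left_conjugate_le_norm_smul (a := a) hb.isSelfAdjoint
  rwa [← Complex.coe_smul] at this

/-- Compressing a selfadjoint element by its negative part. -/
theorem exists_conj_eq_neg {G : A} (hG : IsSelfAdjoint G) :
    ∃ N : A, star N * G * N = -(N * N * N) ∧ 0 ≤ N * N * N ∧ (N * N * N = 0 → 0 ≤ G) := by
  -- The witness is the negative part of `G`, which annihilates the positive part.
  have hN : 0 ≤ G⁻ := CFC.negPart_nonneg G
  have hN' : star G⁻ = G⁻ := hN.isSelfAdjoint.star_eq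
  refine ⟨G⁻, ?_, ?_, fun h0 => ?_⟩
  · have e : G⁻ * (G⁺ - G⁻) = -(G⁻ * G⁻) := by
      rw [mul_sub, CFC.negPart_mul_posPart, zero_sub]
    rw [CFC.posPart_sub_negPart G hG] at e
    rw [hN', e, neg_mul]
  · simpa only [hN'] using star_left_conjugate_nonneg hN G⁻
  · have h1 : G⁻ * G⁻ = 0 := by
      rw [← CStarRing.star_mul_self_eq_zero_iff, star_mul, hN', ← mul_assoc, h0, zero_mul]
    have h2 : G⁻ = 0 := by
      rw [← CStarRing.star_mul_self_eq_zero_iff, hN', h1]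
    rw [← CFC.posPart_sub_negPart G hG, h2, sub_zero]
    exact CFC.posPart_nonneg G

end Positivity

section CStarMatrix

variable {ι A : Type*} [Fintype ι] [NonUnitalCStarAlgebra A] [PartialOrder A] [StarOrderedRing A]

theorem diag_nonneg {M : CStarMatrix ι ι A} (hM : 0 ≤ M)
    (i : ι) : 0 ≤ M i i := by
  obtain ⟨N, rfl⟩ := exists_eq_star_mul_self hM
  rw [CStarMatrix.mul_apply]
  exact Finset.sum_nonneg fun k _ => by
    rw [CStarMatrix.star_apply]; exact star_mul_self_nonneg _

theorem nonneg_of_tendsto_entries {α : Type*} {l : Filter α} [l.NeBot]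
    {M : α → CStarMatrix ι ι A} {N : CStarMatrix ι ι A}
    (h : ∀ i j, Tendsto (fun a => M a i j) l (𝓝 (N i j))) (hM : ∀ a, 0 ≤ M a) : 0 ≤ N := by
  have h' : Tendsto M l (𝓝 N) := tendsto_pi_nhds.mpr fun i => tendsto_pi_nhds.mpr fun j => h i j
  exact ge_of_tendsto' h' hM

/-- The diagonal matrix with entry `c` at the indices in `p` and zero elsewhere. -/
def partialDiag (p : ι → Prop) [DecidablePred p] [DecidableEq ι] :
    A →⋆ₙₐ[ℂ] CStarMatrix ι ι A where
  toFun c := CStarMatrix.ofMatrix fun i j => if i = j ∧ p i then c else 0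
  map_smul' r c := by
    ext i j
    change (if i = j ∧ p i then r • c else 0) = r • (if i = j ∧ p i then c else 0)
    rw [smul_ite, smul_zero]
  map_zero' := by
    ext i j
    exact ite_self _
  map_add' c d := by
    ext i j
    change (if i = j ∧ p i then c + d else 0) =
      (if i = j ∧ p i then c else 0) + (if i = j ∧ p i then d else 0)
    rw [ite_add_ite, add_zero]
  map_mul' c d := by
    ext i j
    change (if i = j ∧ p i then c * d else 0) =
      ∑ k, (if i = k ∧ p i then c else 0) * (if k = j ∧ p k then d else 0)
    rw [Finset.sum_eq_single i (fun k _ hk => by rw [if_neg fun h => hk h.1.symm, zero_mul])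
      (fun h => absurd (Finset.mem_univ i) h)]
    by_cases h : p i <;> simp [h]
  map_star' c := by
    ext i j
    change (if i = j ∧ p i then star c else 0) = star (if j = i ∧ p j then c else 0)
    by_cases h : i = j
    · subst h
      rw [apply_ite star, star_zero]
    · rw [if_neg fun h' => h h'.1, if_neg fun h' => h h'.1.symm, star_zero]

theorem partialDiag_apply (p : ι → Prop) [DecidablePred p] [DecidableEq ι] (c : A) (i j : ι) :
    partialDiag p c i j = if i = j ∧ p i then c else 0 := rfl

theorem norm_partialDiag_le (p : ι → Prop) [DecidablePred p] [DecidableEq ι] (c : A) :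
    ‖partialDiag p c‖ ≤ ‖c‖ :=
  NonUnitalStarAlgHom.norm_apply_le _ c

theorem norm_partialDiag {p : ι → Prop} [DecidablePred p] [DecidableEq ι] {i : ι} (hi : p i)
    (c : A) : ‖partialDiag p c‖ = ‖c‖ := by
  refine le_antisymm (norm_partialDiag_le p c) ?_
  have := CStarMatrix.norm_entry_le_norm (M := partialDiag p c) (i := i) (j := i)
  rwa [partialDiag_apply, if_pos ⟨rfl, hi⟩] at this

end CStarMatrix

section Gram

variable {B : Type*} {E : Type*} [NonUnitalCStarAlgebra B] [PartialOrder B] [StarOrderedRing B]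
  [NormedAddCommGroup E] [NormedSpace ℂ E] [SMul Bᵐᵒᵖ E] [CStarModule Bᵐᵒᵖ E]
  {ι : Type*} [Fintype ι]

variable (B) in
/-- The Gram matrix of a family in a Hilbert module. -/
def gram (x : ι → E) : CStarMatrix ι ι B :=
  CStarMatrix.ofMatrix fun i j => rinner B (x i) (x j)

theorem gram_apply (x : ι → E) (i j : ι) : gram B x i j = rinner B (x i) (x j) := rfl

theorem star_gram (x : ι → E) : star (gram B x) = gram B x := by
  ext i j
  rw [CStarMatrix.star_apply, gram_apply, gram_apply, star_rinner]

theorem conj_gram (x : ι → E) (N : CStarMatrix ι ι B) :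
    star N * gram B x * N = gram B fun i => ∑ k, x k <• N k i := by
  ext i j
  simp only [CStarMatrix.mul_apply, gram_apply, CStarMatrix.star_apply, rinner_sum_left,
    rinner_sum_right, rinner_act_left, rinner_act_right, Finset.sum_mul, mul_assoc]

/-- Compressing by the negative part `N` gives `-N³ ≤ 0`, but also another Gram matrix, whose
diagonal is nonnegative. So the diagonal vanishes, hence so do the vectors, and `N³ = 0`. -/
theorem gram_nonneg (x : ι → E) : 0 ≤ gram B x := by
  obtain ⟨N, e, hpos, h⟩ := exists_conj_eq_neg (G := gram B x) (star_gram x)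
  rw [conj_gram] at e
  refine h ?_
  have hz : ∀ i, ∑ k, x k <• N k i = 0 := fun i => by
    refine rinner_self_eq_zero (B := B) (le_antisymm ?_ (rinner_self_nonneg _))
    have h1 := congrFun (congrFun e i) i
    rw [gram_apply] at h1
    rw [h1]
    exact neg_nonpos.mpr (diag_nonneg hpos i)
  rw [← neg_eq_zero, ← e]
  ext i j
  rw [gram_apply, hz, rinner_zero_left]
  rfl

end Gram

/-! ### Completely positive maps: a Gram criterion and uniform bounds -/

section CompletelyPositive

variable {A D : Type*} [NonUnitalCStarAlgebra A] [PartialOrder A] [StarOrderedRing A]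
  [NonUnitalCStarAlgebra D] [PartialOrder D] [StarOrderedRing D]

/-- A linear map is completely positive if it maps the matrices `(aᵢ* aⱼ)` to positive ones. -/
def cpOfGram (φ : A →ₗ[ℂ] D)
    (h : ∀ (n : ℕ) (a : Fin n → A),
      0 ≤ (CStarMatrix.ofMatrix fun i j => φ (star (a i) * a j) : CStarMatrix (Fin n) (Fin n) D)) :
    A →CP D where
  toLinearMap := φ
  map_cstarMatrix_nonneg' n M hM := by
    obtain ⟨N, rfl⟩ := exists_eq_star_mul_self hM
    -- Splitting `N* N` over the rows of `N` leaves matrices of the form `(a_i* a_j)`.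
    have e : (star N * N).map φ = ∑ k, (CStarMatrix.ofMatrix fun i j =>
        φ (star (N k i) * N k j) : CStarMatrix (Fin n) (Fin n) D) := by
      ext i j
      rw [CStarMatrix.map_apply, CStarMatrix.mul_apply, map_sum]
      simp only [CStarMatrix.star_apply]
      erw [Finset.sum_apply, Finset.sum_apply]
      rfl
    change 0 ≤ (star N * N).map φ
    rw [e]
    exact Finset.sum_nonneg fun k _ => h n (N k)

theorem CompletelyPositiveMap.exists_norm_apply_le (τ : A →CP D) :
    ∃ K : ℝ, 0 ≤ K ∧ ∀ a, ‖τ a‖ ≤ K * ‖a‖ := by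
  obtain ⟨K, hK⟩ := PositiveLinearMap.exists_norm_apply_le
    (PositiveLinearMap.mk₀ (τ : A →ₗ[ℂ] D) fun a ha => map_nonneg τ ha)
  exact ⟨K, K.2, hK⟩

theorem CompletelyPositiveMap.continuous (τ : A →CP D) : Continuous τ := by
  obtain ⟨K, _, hK⟩ := CompletelyPositiveMap.exists_norm_apply_le τ
  exact AddMonoidHomClass.continuous_of_bound τ K hK

/-- The inflations of a completely positive map are uniformly bounded on positive matrices. -/
theorem CompletelyPositiveMap.exists_norm_map_le (τ : A →CP D) :
    ∃ K : ℝ, 0 ≤ K ∧ ∀ (n : ℕ) (P : CStarMatrix (Fin n) (Fin n) A), 0 ≤ P →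
      ‖P.map τ‖ ≤ K * ‖P‖ := by
  obtain ⟨K, hK0, hK⟩ := CompletelyPositiveMap.exists_norm_apply_le τ
  refine ⟨K, hK0, fun n P hP => ?_⟩
  have hl := CStarAlgebra.increasingApproximateUnit A
  -- The domain may lack a unit, so `P ≤ ‖P‖ 1` is not available as an inequality that `τ`
  -- preserves. Compressed by an approximate unit it becomes `Q b ≤ ‖P‖ diag(b* b)`, whose image has
  -- norm at most `‖P‖ ‖τ (b* b)‖`, independently of `n`.
  let Q : A → CStarMatrix (Fin n) (Fin n) A := fun b =>
    star (partialDiag (fun _ => True) b) * P * partialDiag (fun _ => True) b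
  have hQ : ∀ b i j, Q b i j = star b * P i j * b := fun b i j => by
    simp only [Q, CStarMatrix.mul_apply, CStarMatrix.star_apply, partialDiag_apply, and_true,
      apply_ite star, star_zero, ite_mul, zero_mul, mul_ite, mul_zero, Finset.sum_ite_eq',
      Finset.mem_univ, if_true]
  have h1 : Tendsto (fun b => (Q b).map τ) (CStarAlgebra.approximateUnit A) (𝓝 (P.map τ)) := by
    refine tendsto_pi_nhds.mpr fun i => tendsto_pi_nhds.mpr fun j => ?_
    change Tendsto (fun b => τ (Q b i j)) _ (𝓝 (τ (P i j)))
    refine ((CompletelyPositiveMap.continuous τ).tendsto _).comp ?_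
    simp only [hQ]
    have h2 : Tendsto (fun b => b * (P i j * b)) (CStarAlgebra.approximateUnit A)
        (𝓝 (P i j)) := by
      rw [tendsto_iff_norm_sub_tendsto_zero]
      have h3 := ((tendsto_iff_norm_sub_tendsto_zero.mp (hl.tendsto_mul_left (P i j))).add
        (tendsto_iff_norm_sub_tendsto_zero.mp (hl.tendsto_mul_right (P i j))))
      rw [add_zero] at h3
      refine squeeze_zero' (Eventually.of_forall fun _ => norm_nonneg _) ?_ h3
      filter_upwards [hl.eventually_norm] with b hb
      calc ‖b * (P i j * b) - P i j‖ = ‖b * (P i j * b - P i j) + (b * P i j - P i j)‖ := by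
            congr 1; noncomm_ring
        _ ≤ ‖b‖ * ‖P i j * b - P i j‖ + ‖b * P i j - P i j‖ :=
            (norm_add_le _ _).trans (by gcongr; exact norm_mul_le _ _)
        _ ≤ 1 * ‖P i j * b - P i j‖ + ‖b * P i j - P i j‖ := by gcongr
        _ = _ := by rw [one_mul]
    refine h2.congr' ?_
    filter_upwards [hl.eventually_star_eq] with b hb
    rw [hb, mul_assoc]
  refine le_of_tendsto h1.norm ?_
  filter_upwards [hl.eventually_norm] with b hb
  have h3 : 0 ≤ Q b := star_left_conjugate_nonneg hP _
  have h4 : Q b ≤ (‖P‖ : ℂ) • partialDiag (fun _ => True) (star b * b) := by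
    rw [map_mul, map_star]
    exact star_conj_le_norm_smul hP
  have h5 : 0 ≤ (Q b).map τ := τ.map_cstarMatrix_nonneg _ h3
  have h6 : (Q b).map τ ≤ (‖P‖ : ℂ) • partialDiag (fun _ => True) (τ (star b * b)) := by
    rw [← sub_nonneg]
    convert τ.map_cstarMatrix_nonneg _ (sub_nonneg.mpr h4) using 1
    ext i j
    simp only [CStarMatrix.sub_apply, CStarMatrix.map_apply, map_sub, CStarMatrix.smul_apply,
      partialDiag_apply, map_smul]
    split_ifs <;> simp only [map_zero]
  calc ‖(Q b).map τ‖ ≤ ‖(‖P‖ : ℂ) • partialDiag (fun _ => True) (τ (star b * b))‖ :=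
        CStarAlgebra.norm_le_norm_of_nonneg_of_le h5 h6
    _ ≤ ‖P‖ * ‖τ (star b * b)‖ := by
        rw [norm_smul, Complex.norm_real, norm_norm]
        gcongr
        exact norm_partialDiag_le _ _
    _ ≤ ‖P‖ * (K * 1) := by
        gcongr
        refine (hK _).trans ?_
        gcongr
        rw [CStarRing.norm_star_mul_self]
        exact mul_le_one₀ hb (norm_nonneg _) hb
    _ = K * ‖P‖ := by ring

end CompletelyPositive

/-! ### From complete boundedness and adjoint compatibility to the map `τ`, and back -/

section Maps

variable {B C : Type*} {E F : Type*}
  [NonUnitalCStarAlgebra B] [PartialOrder B] [StarOrderedRing B]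
  [NonUnitalCStarAlgebra C] [PartialOrder C] [StarOrderedRing C]
  [NormedAddCommGroup E] [NormedSpace ℂ E] [SMul Bᵐᵒᵖ E] [CStarModule Bᵐᵒᵖ E]
  [NormedAddCommGroup F] [NormedSpace ℂ F] [SMul Cᵐᵒᵖ F] [CStarModule Cᵐᵒᵖ F]

theorem star_rankOne (x y : E) : star (rankOne x y : Adj B E) = rankOne y x :=
  Adj.eq_star fun z w => by
    rw [rankOne_apply, rankOne_apply, rinner_act_left, rinner_act_right, star_rinner]

variable (B C) in
/-- The columns `Tⁿ : Eⁿ → Fⁿ` are bounded uniformly in `n`. -/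
def IsColumnBounded (T : E →ₗ[ℂ] F) : Prop :=
  ∃ K : ℝ, 0 ≤ K ∧ ∀ (n : ℕ) (w : Fin n → E),
    ‖∑ i, rinner C (T (w i)) (T (w i))‖ ≤ K * ‖∑ i, rinner B (w i) (w i)‖

variable (B C) in
/-- `T` turns adjoint operators on `E` into formally adjoint ones on the range of `T`. -/
def IsAdjointCompatible (T : E →ₗ[ℂ] F) : Prop :=
  ∀ (a : Adj B E) (x y : E), rinner C (T x) (T (a.1 y)) = rinner C (T ((star a).1 x)) (T y)

variable {T : E →ₗ[ℂ] F}

/-- With all other columns zero, the matrix inner product has a single possibly nonzero entry, at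
`(0, 0)`. This embeds columns isometrically in square matrices; the size `n + 1` supplies the index
`0`. -/
theorem matrixNorm_single_column {n : ℕ} (w : Fin (n + 1) → E) :
    matrixNorm B (Matrix.of fun k (i : Fin (n + 1)) => if i = 0 then w k else 0) =
      √‖∑ k, rinner B (w k) (w k)‖ := by
  have e : (CStarMatrix.ofMatrix fun i j => ∑ k, rinner B (if i = 0 then w k else 0)
      (if j = 0 then w k else 0) : CStarMatrix (Fin (n + 1)) (Fin (n + 1)) B) =
      partialDiag (fun i => i = 0) (∑ k, rinner B (w k) (w k)) := by
    ext i j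
    change ∑ k, rinner B (if i = 0 then w k else 0) (if j = 0 then w k else 0) =
      if i = j ∧ i = 0 then ∑ k, rinner B (w k) (w k) else 0
    by_cases hi : i = 0
    · by_cases hj : j = 0
      · simp [hi, hj]
      · simp [hi, hj, Ne.symm hj, rinner_zero_right]
    · simp [hi, rinner_zero_left]
  unfold matrixNorm
  simp only [Matrix.of_apply]
  rw [e, norm_partialDiag (p := fun i => i = 0) rfl]

theorem IsCompletelyBounded.isColumnBounded (h : IsCompletelyBounded B C T) :
    IsColumnBounded B C T := by
  obtain ⟨K, hK⟩ := h
  refine ⟨K ^ 2, by positivity, fun n w => ?_⟩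
  obtain - | n := n
  · simp
  have h := hK (n + 1) (Matrix.of fun k i => if i = 0 then w k else 0)
  have e : Matrix.map (Matrix.of fun k (i : Fin (n + 1)) => if i = 0 then w k else 0) T =
      Matrix.of fun k (i : Fin (n + 1)) => if i = 0 then T (w k) else 0 := by
    ext k i
    rw [Matrix.map_apply, Matrix.of_apply, Matrix.of_apply, apply_ite T, map_zero]
  rw [e, matrixNorm_single_column, matrixNorm_single_column] at h
  have h2 := pow_le_pow_left₀ (Real.sqrt_nonneg _) h 2
  rwa [mul_pow, Real.sq_sqrt (norm_nonneg _), Real.sq_sqrt (norm_nonneg _)] at h2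

theorem IsColumnBounded.continuous (h : IsColumnBounded B C T) : Continuous T := by
  obtain ⟨K, hK0, hK⟩ := h
  refine AddMonoidHomClass.continuous_of_bound T (√K) fun x => ?_
  refine abs_le_of_sq_le_sq' ?_ (by positivity) |>.2
  rw [mul_pow, Real.sq_sqrt hK0, norm_sq_eq (B := C), norm_sq_eq (B := B)]
  simpa using hK 1 fun _ => x

/-- Approximate `y` by sums of `y ⟨w_j, w_j⟩`. The quaternary identity turns the two sides into `⟨T
(w_j ⟨a y, x⟩), T w_j⟩` and `⟨T (w_j ⟨y, a* x⟩), T w_j⟩`, which agree. -/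
theorem IsQuaternary.isAdjointCompatible (h : IsQuaternary B C T) (hT : Continuous T) :
    IsAdjointCompatible B C T := by
  intro a x y
  classical
  obtain ⟨w, hw1, hw⟩ := exists_column_net B E
  have key : ∀ i, rinner C (T x) (T (a.1 (y <• ∑ j, rinner B (w i j) (w i j)))) =
      rinner C (T ((star a).1 x)) (T (y <• ∑ j, rinner B (w i j) (w i j))) := fun i => by
    simp only [act_sum, map_sum, rinner_sum_right]
    refine Finset.sum_congr rfl fun j _ => ?_
    rw [Adj.map_act, h, h, Adj.rinner_apply_left]
  refine tendsto_nhds_unique (f := fun i =>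
    rinner C (T x) (T (a.1 (y <• ∑ j, rinner B (w i j) (w i j))))) (l := atTop) ?_ ?_
  · exact tendsto_const_nhds.rinner ((hT.comp a.1.continuous).tendsto _ |>.comp (hw y))
  · simp only [key]
    exact tendsto_const_nhds.rinner (hT.tendsto _ |>.comp (hw y))

/-- This is adjoint compatibility for rank-one operators. -/
theorem IsAdjointCompatible.isQuaternary (h : IsAdjointCompatible B C T) :
    IsQuaternary B C T := by
  intro x y x' y'
  have := h (rankOne x x') y y'
  rwa [star_rankOne] at this

theorem IsTauMap.isAdjointCompatible {τ : B →CP C} (h : IsTauMap τ T) :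
    IsAdjointCompatible B C T := fun a x y => by
  rw [h, h, Adj.rinner_apply_right]

/-- The squared matrix norm is the norm of a sum of Gram matrices, one for each row `k`; such a sum
is positive and `τ` maps it entrywise to the one for `T`. -/
theorem IsTauMap.isCompletelyBounded {τ : B →CP C} (h : IsTauMap τ T) :
    IsCompletelyBounded B C T := by
  obtain ⟨K, hK0, hK⟩ := CompletelyPositiveMap.exists_norm_map_le τ
  refine ⟨√K, fun n X => ?_⟩
  rw [matrixNorm, matrixNorm, ← Real.sqrt_mul hK0]
  refine Real.sqrt_le_sqrt ?_
  have e : (CStarMatrix.ofMatrix fun i j => ∑ k, rinner B (X k i) (X k j) :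
      CStarMatrix (Fin n) (Fin n) B) = ∑ k, gram B (X k) := by
    ext i j
    erw [Finset.sum_apply, Finset.sum_apply]
    rfl
  convert hK n _ (e ▸ Finset.sum_nonneg fun k _ => gram_nonneg (B := B) (X k)) using 2
  ext i j
  change ∑ k, rinner C (T (X k i)) (T (X k j)) = τ (∑ k, rinner B (X k i) (X k j))
  rw [map_sum]
  exact Finset.sum_congr rfl fun k _ => h _ _

theorem IsTauMap.unique (hE : IsFull B E) {τ τ' : B →CP C} (h : IsTauMap τ T)
    (h' : IsTauMap τ' T) : τ = τ' := by
  refine DFunLike.coe_injective (Continuous.ext_on (s := Submodule.span ℂ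
    {b : B | ∃ x y : E, b = rinner B x y}) ?_ (CompletelyPositiveMap.continuous τ)
    (CompletelyPositiveMap.continuous τ') fun b hb => ?_)
  · exact (Submodule.dense_iff_topologicalClosure_eq_top).mpr hE
  · refine LinearMap.eqOn_span (f := (τ : B →ₗ[ℂ] C)) (g := (τ' : B →ₗ[ℂ] C)) ?_ hb
    rintro _ ⟨x, y, rfl⟩
    exact (h x y).symm.trans (h' x y)

/-- The bound making `⟨x, y⟩ ↦ ⟨T x, T y⟩` extend to the span of the inner products. -/
theorem exists_norm_linearCombination_le (h : IsAdjointCompatible B C T)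
    (hT : IsColumnBounded B C T) : ∃ K : ℝ, ∀ p : E × E →₀ ℂ,
      ‖Finsupp.linearCombination ℂ (fun v : E × E => rinner C (T v.1) (T v.2)) p‖ ≤
        K * ‖Finsupp.linearCombination ℂ (fun v : E × E => rinner B v.1 v.2) p‖ := by
  have hc := hT.continuous
  obtain ⟨K, hK0, hK⟩ := hT
  classical
  obtain ⟨w, hw1, hw⟩ := exists_column_net B E
  refine ⟨K, fun p => ?_⟩
  set q := fun i => ∑ j, rinner B (w i j) (w i j) with hq
  have h1 : Tendsto (fun i => Finsupp.linearCombination ℂ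
      (fun v : E × E => rinner C (T v.1) (T (v.2 <• q i))) p) atTop
      (𝓝 (Finsupp.linearCombination ℂ (fun v : E × E => rinner C (T v.1) (T v.2)) p)) := by
    simp only [Finsupp.linearCombination_apply, Finsupp.sum]
    exact tendsto_finsetSum _ fun v _ => (tendsto_const_nhds.rinner
      ((hc.tendsto _).comp (hw v.2))).const_smul _
  refine le_of_tendsto' h1.norm fun i => ?_
  set β := Finsupp.linearCombination ℂ (fun v : E × E => rinner B v.1 v.2) p with hβ
  -- Linearity in `p` reduces this to one pair, where the quaternary identity moves `⟨x, y⟩` onto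
  -- `w_j`. Only the total `β` survives, which is what makes a bound by `‖β‖` possible.
  have e : Finsupp.linearCombination ℂ
      (fun v : E × E => rinner C (T v.1) (T (v.2 <• q i))) p =
      ∑ j, rinner C (T (w i j <• star β)) (T (w i j)) := by
    rw [hβ]
    clear h1 hβ β
    induction p using Finsupp.induction_linear with
    | zero => simp only [map_zero, star_zero, act_zero, rinner_zero_left, Finset.sum_const_zero]
    | add p p' hp hp' =>
      simp only [map_add, star_add, act_add, rinner_add_left, Finset.sum_add_distrib] at hp hp' ⊢
      rw [hp, hp']
    | single v r =>
      simp only [Finsupp.linearCombination_single, star_smul, star_rinner, act_smul, map_smul,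
        rinner_smul_left, star_star, hq, act_sum, map_sum, rinner_sum_right, Finset.smul_sum]
      exact Finset.sum_congr rfl fun j _ => by rw [h.isQuaternary]
  have e2 : ∑ j, rinner B (w i j <• star β) (w i j <• star β) = β * q i * star β := by
    simp only [rinner_act_left, rinner_act_right, star_star, hq, Finset.sum_mul, Finset.mul_sum,
      mul_assoc]
  rw [e]
  calc _ ≤ √‖∑ j, rinner C (T (w i j <• star β)) (T (w i j <• star β))‖ *
        √‖∑ j, rinner C (T (w i j)) (T (w i j))‖ := norm_sum_rinner_le _ _
    _ ≤ √(K * (‖β‖ * 1 * ‖β‖)) * √(K * 1) := by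
      gcongr
      · refine (hK _ _).trans ?_
        gcongr
        rw [e2]
        refine (norm_mul_le _ _).trans ?_
        rw [norm_star]
        gcongr
        refine (norm_mul_le _ _).trans ?_
        gcongr
        exact hw1 i
      · refine (hK _ _).trans ?_
        gcongr
        exact hw1 i
    _ = K * ‖β‖ := by
      rw [← Real.sqrt_mul (by positivity), ← Real.sqrt_sq (x := K * ‖β‖) (by positivity)]
      congr 1
      ring

theorem exists_isTauMap (hE : IsFull B E) (h : IsAdjointCompatible B C T)
    (hT : IsColumnBounded B C T) : ∃ τ : B →CP C, IsTauMap τ T := by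
  have hb := exists_norm_linearCombination_le h hT
  set e := Finsupp.linearCombination ℂ (fun v : E × E => rinner B v.1 v.2)
  set f := Finsupp.linearCombination ℂ (fun v : E × E => rinner C (T v.1) (T v.2))
  have hd : DenseRange e := by
    have : Dense (LinearMap.range e : Set B) := by
      rw [Submodule.dense_iff_topologicalClosure_eq_top, ← hE, Finsupp.range_linearCombination]
      congr 2
      ext b
      simp [eq_comm]
    exact this
  let τ : B →L[ℂ] C := f.extendOfNorm e
  have hτ : ∀ x y, τ (rinner B x y) = rinner C (T x) (T y) := fun x y => by
    have := LinearMap.extendOfNorm_eq (f := f) hd hb (Finsupp.single (x, y) 1)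
    simpa [e, f] using this
  refine ⟨cpOfGram τ fun n a => ?_, fun x y => (hτ x y).symm⟩
  classical
  obtain ⟨w, hw1, hw⟩ := exists_column_net B E
  -- Inserting `q` gives `τ(a_k* q a_k') = ∑ ⟨T (w_l a_k), T (w_l a_k')⟩`, a sum of Gram entries;
  -- fullness lets `q` be removed in the limit.
  refine nonneg_of_tendsto_entries (l := atTop) (M := fun i =>
    ∑ l, gram C fun k => T (w i l <• a k)) (fun k k' => ?_)
    fun i => Finset.sum_nonneg fun l _ => gram_nonneg _
  have e1 : ∀ i, (∑ l, gram C fun k => T (w i l <• a k)) k k' =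
      τ (star (a k) * (∑ l, rinner B (w i l) (w i l)) * a k') := fun i => by
    erw [Finset.sum_apply, Finset.sum_apply]
    simp only [gram_apply, ← hτ, rinner_act_left, rinner_act_right, Finset.mul_sum,
      Finset.sum_mul, map_sum, mul_assoc]
  simp only [e1]
  refine (τ.continuous.tendsto _).comp ?_
  exact (tendsto_of_isFull hE hw1 hw _).mul_const _

end Maps

/-! ### The representation of the adjointable operators on `F_T` -/

theorem ext_act {B E : Type*} [NonUnitalCStarAlgebra B] [PartialOrder B] [StarOrderedRing B]
    [NormedAddCommGroup E] [NormedSpace ℂ E] [SMul Bᵐᵒᵖ E] [CStarModule Bᵐᵒᵖ E] {x y : E}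
    (h : ∀ b : B, x <• b = y <• b) : x = y := by
  rw [← sub_eq_zero]
  refine rinner_self_eq_zero (B := B) ?_
  rw [← CStarRing.star_mul_self_eq_zero_iff, star_rinner, ← rinner_act_right]
  rw [sub_eq_add_neg, add_act, neg_act, h, add_neg_cancel, rinner_zero_right]

section Representation

variable {B C : Type*} {E F : Type*}
  [NonUnitalCStarAlgebra B] [PartialOrder B] [StarOrderedRing B]
  [NonUnitalCStarAlgebra C] [PartialOrder C] [StarOrderedRing C]
  [NormedAddCommGroup E] [NormedSpace ℂ E] [CompleteSpace E]
  [SMul Bᵐᵒᵖ E] [CStarModule Bᵐᵒᵖ E]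
  [NormedAddCommGroup F] [NormedSpace ℂ F] [CompleteSpace F]
  [SMul Cᵐᵒᵖ F] [CStarModule Cᵐᵒᵖ F]

namespace Gen

variable (C) in
/-- `T`, viewed as a linear map into `F_T`. -/
def mkₗ (T : E →ₗ[ℂ] F) : E →ₗ[ℂ] Gen C T where
  toFun := mk C T
  map_add' x y := Subtype.ext (map_add T x y)
  map_smul' r x := Subtype.ext (map_smul T r x)

variable {T : E →ₗ[ℂ] F}

theorem mkₗ_apply (x : E) : mkₗ C T x = mk C T x := rfl

theorem rinner_mk (x y : E) : rinner C (mk C T x) (mk C T y) = rinner C (T x) (T y) := rfl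

variable (C T) in
theorem dense_span :
    Dense (Submodule.span ℂ {z : Gen C T | ∃ (x : E) (c : C), z = mk C T x <• c} :
      Set (Gen C T)) := by
  intro z
  let j : Gen C T →ₗ[ℂ] F := (genSubmodule C T).subtype
  have e : j '' {z : Gen C T | ∃ (x : E) (c : C), z = mk C T x <• c} =
      {y : F | ∃ (x : E) (c : C), y = T x <• c} := by
    ext y
    constructor
    · rintro ⟨_, ⟨x, c, rfl⟩, rfl⟩
      exact ⟨x, c, rfl⟩
    · rintro ⟨x, c, rfl⟩
      exact ⟨_, ⟨x, c, rfl⟩, rfl⟩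
  have hz : z.1 ∈ closure (Submodule.span ℂ {y : F | ∃ (x : E) (c : C), y = T x <• c} : Set F) :=
    z.2
  rw [Metric.mem_closure_iff] at hz ⊢
  intro ε hε
  obtain ⟨y, hy, hyz⟩ := hz ε hε
  rw [← e, ← Submodule.map_span] at hy
  obtain ⟨w, hw, rfl⟩ := hy
  exact ⟨w, hw, hyz⟩

end Gen

variable {T : E →ₗ[ℂ] F}

variable (C T) in
/-- The map `∑ (x, c) ↦ ∑ T (a x) c`. -/
noncomputable def genMap (a : Adj B E) : (E × C →₀ ℂ) →ₗ[ℂ] Gen C T :=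
  Finsupp.linearCombination ℂ fun v : E × C => Gen.mk C T (a.1 v.1) <• v.2

theorem genMap_single (a : Adj B E) (x : E) (c : C) (r : ℂ) :
    genMap C T a (Finsupp.single (x, c) r) = r • (Gen.mk C T (a.1 x) <• c) :=
  Finsupp.linearCombination_single ..

variable (B C T) in
theorem denseRange_genMap_one : DenseRange (genMap C T (1 : Adj B E)) := by
  have : Dense (LinearMap.range (genMap C T (1 : Adj B E)) : Set (Gen C T)) := by
    rw [genMap, Finsupp.range_linearCombination]
    convert Gen.dense_span C T using 3
    ext z
    constructor
    · rintro ⟨⟨x, c⟩, rfl⟩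
      exact ⟨x, c, rfl⟩
    · rintro ⟨x, c, rfl⟩
      exact ⟨(x, c), rfl⟩
  exact this

theorem genMap_sub (a b : Adj B E) (p : E × C →₀ ℂ) :
    genMap C T (a - b) p = genMap C T a p - genMap C T b p := by
  induction p using Finsupp.induction_linear with
  | zero => simp only [map_zero, sub_zero]
  | add p q hp hq => rw [map_add, map_add, map_add, hp, hq]; abel
  | single v r =>
    obtain ⟨x, c⟩ := v
    rw [genMap_single, genMap_single, genMap_single, ← smul_sub, sub_eq_add_neg _ (_ <• _),
      ← neg_act, ← add_act]
    congr 2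
    change Gen.mkₗ C T (a.1 x - b.1 x) = Gen.mkₗ C T (a.1 x) + -Gen.mkₗ C T (b.1 x)
    rw [map_sub, sub_eq_add_neg]

theorem genMap_smul_one (r : ℂ) (p : E × C →₀ ℂ) :
    genMap C T (r • (1 : Adj B E)) p = r • genMap C T (1 : Adj B E) p := by
  induction p using Finsupp.induction_linear with
  | zero => simp only [map_zero, smul_zero]
  | add p q hp hq => rw [map_add, map_add, hp, hq, smul_add]
  | single v s =>
    obtain ⟨x, c⟩ := v
    rw [genMap_single, genMap_single, smul_comm r s, ← smul_act r]
    congr 2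
    exact map_smul (Gen.mkₗ C T) r x

/-- By compatibility, the inner product of `T (a x)` and `T (b y)` depends on `a` and `b` only
through `a* b`. -/
theorem IsAdjointCompatible.rinner_genMap (h : IsAdjointCompatible B C T) (a b c d : Adj B E)
    (hab : star a * b = star c * d) (p q : E × C →₀ ℂ) :
    rinner C (genMap C T a p) (genMap C T b q) = rinner C (genMap C T c p) (genMap C T d q) := by
  induction p using Finsupp.induction_linear with
  | zero => rw [map_zero, map_zero, rinner_zero_left, rinner_zero_left]
  | add p p' hp hp' => rw [map_add, map_add, rinner_add_left, rinner_add_left, hp, hp']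
  | single v r =>
    induction q using Finsupp.induction_linear with
    | zero => rw [map_zero, map_zero, rinner_zero_right, rinner_zero_right]
    | add q q' hq hq' => rw [map_add, map_add, rinner_add_right, rinner_add_right, hq, hq']
    | single w s =>
      obtain ⟨x, e⟩ := v
      obtain ⟨y, f⟩ := w
      simp only [genMap_single, rinner_smul_left, rinner_smul_right, rinner_act_left,
        rinner_act_right, Gen.rinner_mk]
      have h1 : ∀ a b : Adj B E,
          rinner C (T (a.1 x)) (T (b.1 y)) = rinner C (T x) (T ((star a * b).1 y)) := fun a b => by
        have := h (star a) x (b.1 y)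
        rw [star_star] at this
        exact this.symm
      rw [h1, h1, hab]

/-- Write `‖a‖² - a* a = d* d`; then `‖a‖² ⟨p, p⟩ - ⟨a p, a p⟩ = ⟨d p, d p⟩ ≥ 0`. The bound also
shows that the action is well defined on the span of the `T (x) c`. -/
theorem IsAdjointCompatible.norm_genMap_le (h : IsAdjointCompatible B C T) (a : Adj B E)
    (p : E × C →₀ ℂ) : ‖genMap C T a p‖ ≤ ‖a‖ * ‖genMap C T (1 : Adj B E) p‖ := by
  let := CStarAlgebra.spectralOrder (Adj B E)
  let := CStarAlgebra.spectralOrderedRing (Adj B E)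
  have h1 : star a * a ≤ algebraMap ℝ (Adj B E) (‖a‖ ^ 2) :=
    CStarAlgebra.star_mul_le_algebraMap_norm_sq
  obtain ⟨d, hd⟩ := exists_eq_star_mul_self (sub_nonneg.mpr h1)
  have e1 : algebraMap ℝ (Adj B E) (‖a‖ ^ 2) = ((‖a‖ ^ 2 : ℝ) : ℂ) • (1 : Adj B E) := by
    rw [Algebra.algebraMap_eq_smul_one, Complex.coe_smul]
  have e2 : rinner C (genMap C T d p) (genMap C T d p) =
      ((‖a‖ ^ 2 : ℝ) : ℂ) • rinner C (genMap C T (1 : Adj B E) p) (genMap C T (1 : Adj B E) p) -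
        rinner C (genMap C T a p) (genMap C T a p) := by
    rw [h.rinner_genMap d d 1 (star d * d) (by rw [star_one, one_mul]), ← hd, genMap_sub,
      rinner_sub_right, e1, genMap_smul_one, rinner_smul_right,
      h.rinner_genMap a a 1 (star a * a) (by rw [star_one, one_mul])]
  have h2 : rinner C (genMap C T a p) (genMap C T a p) ≤
      ((‖a‖ ^ 2 : ℝ) : ℂ) • rinner C (genMap C T (1 : Adj B E) p) (genMap C T (1 : Adj B E) p) := by
    rw [← sub_nonneg, ← e2]
    exact rinner_self_nonneg _
  refine abs_le_of_sq_le_sq' ?_ (by positivity) |>.2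
  have h3 := CStarAlgebra.norm_le_norm_of_nonneg_of_le (rinner_self_nonneg _) h2
  rwa [norm_smul, Complex.norm_real, Real.norm_of_nonneg (by positivity), ← norm_sq_eq,
    ← norm_sq_eq, ← mul_pow] at h3

variable (B C T) in
/-- The action of `𝓑ᵃ(E)` on `F_T` as bounded operators. -/
noncomputable def genAct (a : Adj B E) : Gen C T →L[ℂ] Gen C T :=
  (genMap C T a).extendOfNorm (genMap C T (1 : Adj B E))

theorem IsAdjointCompatible.genAct_genMap (h : IsAdjointCompatible B C T) (a : Adj B E)
    (p : E × C →₀ ℂ) : genAct B C T a (genMap C T (1 : Adj B E) p) = genMap C T a p :=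
  LinearMap.extendOfNorm_eq (denseRange_genMap_one B C T) ⟨‖a‖, h.norm_genMap_le a⟩ p

theorem IsAdjointCompatible.genAct_mk_act (h : IsAdjointCompatible B C T) (a : Adj B E)
    (x : E) (c : C) : genAct B C T a (Gen.mk C T x <• c) = Gen.mk C T (a.1 x) <• c := by
  have := h.genAct_genMap a (Finsupp.single (x, c) 1)
  rwa [genMap_single, genMap_single, one_smul, one_smul] at this

/-- Bounded operators on `F_T` agree if they agree on the vectors `T(x) c`. -/
theorem ext_gen {f g : Gen C T →L[ℂ] Gen C T}
    (h : ∀ (x : E) (c : C), f (Gen.mk C T x <• c) = g (Gen.mk C T x <• c)) : f = g := by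
  refine ContinuousLinearMap.ext_on (Gen.dense_span C T) ?_
  rintro _ ⟨x, c, rfl⟩
  exact h x c

theorem IsAdjointCompatible.rinner_genAct (h : IsAdjointCompatible B C T) (a : Adj B E)
    (z w : Gen C T) :
    rinner C (genAct B C T a z) w = rinner C z (genAct B C T (star a) w) := by
  have hd := denseRange_genMap_one B C T
  refine hd.induction_on₂ (p := fun z w => rinner C (genAct B C T a z) w =
    rinner C z (genAct B C T (star a) w)) ?_ (fun p q => ?_) z w
  · refine isClosed_eq ?_ ?_
    · exact (continuous_rinner C).comp
        (((genAct B C T a).continuous.comp continuous_fst).prodMk continuous_snd)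
    · exact (continuous_rinner C).comp
        (continuous_fst.prodMk ((genAct B C T (star a)).continuous.comp continuous_snd))
  · rw [h.genAct_genMap, h.genAct_genMap]
    exact h.rinner_genMap _ _ _ _ (by simp) _ _

/-- The homomorphism `ϑ : 𝓑ᵃ(E) → 𝓑ᵃ(F_T)` with `ϑ(a) T(x) = T(a x)`. -/
noncomputable def IsAdjointCompatible.rep (h : IsAdjointCompatible B C T) :
    Adj B E →⋆ₙₐ[ℂ] Adj C (Gen C T) where
  toFun a := ⟨genAct B C T a, genAct B C T (star a), h.rinner_genAct a⟩
  map_smul' r a := Subtype.ext (ext_gen fun x c => by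
    change genAct B C T (r • a) _ = r • genAct B C T a _
    rw [h.genAct_mk_act, h.genAct_mk_act, ← smul_act]
    congr 1
    exact map_smul (Gen.mkₗ C T) r (a.1 x))
  map_zero' := Subtype.ext (ext_gen fun x c => by
    change genAct B C T 0 _ = 0
    rw [h.genAct_mk_act]
    exact (congrArg (· <• c) (map_zero (Gen.mkₗ C T))).trans (zero_act c))
  map_add' a b := Subtype.ext (ext_gen fun x c => by
    change genAct B C T (a + b) _ = genAct B C T a _ + genAct B C T b _
    rw [h.genAct_mk_act, h.genAct_mk_act, h.genAct_mk_act, ← add_act]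
    congr 1
    exact map_add (Gen.mkₗ C T) (a.1 x) (b.1 x))
  map_mul' a b := Subtype.ext (ext_gen fun x c => by
    change genAct B C T (a * b) _ = genAct B C T a (genAct B C T b _)
    rw [h.genAct_mk_act, h.genAct_mk_act, h.genAct_mk_act]
    rfl)
  map_star' a := (Adj.eq_star (h.rinner_genAct a)).symm

theorem IsAdjointCompatible.rep_mk (h : IsAdjointCompatible B C T) (a : Adj B E) (x : E) :
    (h.rep a).1 (Gen.mk C T x) = Gen.mk C T (a.1 x) :=
  -- The action is known only on vectors `T (x) c`; the factor `c` can be cancelled because `C`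
  -- separates vectors.
  ext_act (B := C) fun c => by
    rw [← Adj.map_act]
    exact h.genAct_mk_act a x c

theorem IsAdjointCompatible.rep_one (h : IsAdjointCompatible B C T) : h.rep 1 = 1 :=
  Subtype.ext (ext_gen fun x c => h.genAct_mk_act 1 x c)

/-- Nondegeneracy comes from `rep` being unital. -/
theorem IsAdjointCompatible.isLeftLinearizable (h : IsAdjointCompatible B C T) :
    IsLeftLinearizable B C T := by
  refine ⟨⟨h.rep, ?_⟩, fun a x => (h.rep_mk a x).symm⟩
  refine top_le_iff.mp fun z _ => Submodule.le_topologicalClosure _ (Submodule.subset_span ?_)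
  exact ⟨1, z, by rw [h.rep_one]; rfl⟩

theorem IsLeftLinearizable.isAdjointCompatible (h : IsLeftLinearizable B C T) :
    IsAdjointCompatible B C T := by
  obtain ⟨L, hL⟩ := h
  intro a x y
  rw [← Gen.rinner_mk, hL, Adj.rinner_apply_right, ← map_star, ← hL, Gen.rinner_mk]

end Representation

/-! ### Calculus in the extended linking algebra -/

theorem rowGram_nonneg {ι A : Type*} [Fintype ι] [NonUnitalCStarAlgebra A] [PartialOrder A]
    [StarOrderedRing A] (r : ι → A) :
    0 ≤ (CStarMatrix.ofMatrix fun i j => star (r i) * r j : CStarMatrix ι ι A) :=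
  -- A Gram matrix in the algebra regarded as a Hilbert module over itself.
  gram_nonneg (B := A) (E := Aᵐᵒᵖ) fun i => op (r i)

section LinkingAlgebra

variable {B : Type*} {E : Type*} [NonUnitalCStarAlgebra B] [PartialOrder B] [StarOrderedRing B]
  [NormedAddCommGroup E] [NormedSpace ℂ E] [SMul Bᵐᵒᵖ E] [CStarModule Bᵐᵒᵖ E]

theorem blk_apply (b : B) (x y : E) (t : Adj B E) (c : B) (z : E) :
    (blk b x y t).1.1 (col c z) = col (b * c + rinner B y z) (x <• c + t.1 z) := rfl

variable [CompleteSpace E]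

theorem blk_star (b : B) (x y : E) (t : Adj B E) :
    star (blk b x y t) = blk (star b) y x (star t) :=
  Subtype.ext (block_star b x y t)

theorem blk_add (b b' : B) (x x' y y' : E) (t t' : Adj B E) :
    blk b x y t + blk b' x' y' t' = blk (b + b') (x + x') (y + y') (t + t') :=
  Subtype.ext (block_add b b' x x' y y' t t').symm

theorem blk_smul (r : ℂ) (b : B) (x y : E) (t : Adj B E) :
    r • blk b x y t = blk (r • b) (r • x) (star r • y) (r • t) :=
  Subtype.ext (block_smul r b x y t).symm

theorem blk_mul (b b' : B) (x x' y y' : E) (t t' : Adj B E) :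
    blk b x y t * blk b' x' y' t' =
      blk (b * b' + rinner B y x') (x <• b' + t.1 x') (y' <• star b + (star t').1 y)
        (rankOne x y' + t * t') :=
  Subtype.ext (block_mul b b' x x' y y' t t')

theorem rankOne_zero_left (y : E) : rankOne (0 : E) y = (0 : Adj B E) :=
  Adj.ext fun z => zero_act (rinner B y z)

theorem Adj.zero_apply (x : E) : (0 : Adj B E).1 x = 0 := rfl

theorem Adj.one_apply (x : E) : (1 : Adj B E).1 x = x := rfl

theorem norm_blk_le (b : B) (x y : E) (t : Adj B E) :
    ‖blk b x y t‖ ≤ (‖b‖ + ‖y‖) + (‖x‖ + ‖t‖) :=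
  norm_block_le b x y t

theorem norm_blk_ge (b : B) (x y : E) (t : Adj B E) :
    ‖b‖ ≤ ‖blk b x y t‖ ∧ ‖x‖ ≤ ‖blk b x y t‖ ∧ ‖y‖ ≤ ‖blk b x y t‖ ∧
      ‖t‖ ≤ ‖blk b x y t‖ :=
  norm_block_ge b x y t

theorem tendsto_blk {α : Type*} {l : Filter α} {b : α → B} {y : α → E} {b₀ : B} {y₀ : E}
    (x : E) (t : Adj B E) (hb : Tendsto b l (𝓝 b₀)) (hy : Tendsto y l (𝓝 y₀)) :
    Tendsto (fun i => blk (b i) x (y i) t) l (𝓝 (blk b₀ x y₀ t)) := by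
  rw [tendsto_iff_norm_sub_tendsto_zero] at hb hy ⊢
  have h := hb.add hy
  rw [add_zero] at h
  refine squeeze_zero (fun _ => norm_nonneg _) (fun i => ?_) h
  have e : blk (b i) x (y i) t - blk b₀ x y₀ t = blk (b i - b₀) 0 (y i - y₀) 0 := by
    rw [sub_eq_iff_eq_add, blk_add, sub_add_cancel, sub_add_cancel, zero_add, zero_add]
  rw [e]
  refine (norm_blk_le _ _ _ _).trans_eq ?_
  rw [norm_zero, norm_zero (E := Adj B E), add_zero, add_zero]

/-- Evaluation of elements of the linking algebra at a column. -/
noncomputable def evalCol (v : Col B E) : Linking B E →+ Col B E where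
  toFun a := a.1.1 v
  map_zero' := rfl
  map_add' _ _ := rfl

/-- A positive matrix over the linking algebra gives a positive form on columns. -/
theorem quadratic_form_nonneg {ι : Type*} [Fintype ι] {P : CStarMatrix ι ι (Linking B E)}
    (hP : 0 ≤ P) (v : ι → Col B E) : 0 ≤ ∑ i, ∑ j, rinner B (v i) ((P i j).1.1 (v j)) := by
  obtain ⟨N, rfl⟩ := exists_eq_star_mul_self hP
  have e (i j : ι) : rinner B (v i) (((star N * N) i j).1.1 (v j)) =
      ∑ k, rinner B ((N k i).1.1 (v i)) ((N k j).1.1 (v j)) := by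
    change rinner B (v i) (evalCol (v j) ((star N * N) i j)) = _
    rw [CStarMatrix.mul_apply, map_sum, rinner_sum_right]
    refine Finset.sum_congr rfl fun k _ => ?_
    rw [CStarMatrix.star_apply, Adj.rinner_apply_left]
    rfl
  have e' : ∑ i, ∑ j, rinner B (v i) (((star N * N) i j).1.1 (v j)) =
      ∑ k, rinner B (∑ i, (N k i).1.1 (v i)) (∑ j, (N k j).1.1 (v j)) := by
    simp only [rinner_sum_left, rinner_sum_right, e]
    rw [Finset.sum_comm]
    rw [Finset.sum_congr rfl fun j _ => Finset.sum_comm, Finset.sum_comm]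
  rw [e']
  exact Finset.sum_nonneg fun k _ => rinner_self_nonneg _

/-- Second rows are stable under right multiplication, so a rule for products `r* r'` of rows also
applies to `(r a)* (r a')`. -/
theorem exists_row_eq_mul (x : E) (t : Adj B E) (a : Linking B E) :
    ∃ x' t', blk 0 x 0 t * a = (blk 0 x' 0 t' : Linking B E) := by
  obtain ⟨b, x', y', t', rfl⟩ := blk_surjective a
  refine ⟨x <• b + t.1 x', rankOne x y' + t * t', ?_⟩
  rw [blk_mul, zero_mul, rinner_zero_left, add_zero, star_zero, act_zero, map_zero, add_zero]

/-- Expresses `diag(q, 1)` as a sum of squares `r* r` of second rows; by `tendsto_blk_unit_mul` such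
elements form a left approximate unit. -/
theorem blk_unit_eq_sum {n : ℕ} (w : Fin n → E) :
    (blk (∑ l, rinner B (w l) (w l)) 0 0 1 : Linking B E) =
      ∑ l, star (blk 0 (w l) 0 0) * blk 0 (w l) 0 0 + star (blk 0 0 0 1) * blk 0 0 0 1 := by
  let c : B →+ Linking B E := AddMonoidHom.mk' (fun b => blk b 0 0 0) fun b b' => by
    rw [blk_add, add_zero, add_zero]
  have h1 (l : Fin n) : star (blk 0 (w l) 0 (0 : Adj B E)) * blk 0 (w l) 0 0 =
      c (rinner B (w l) (w l)) := by
    change _ = blk _ _ _ _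
    rw [blk_star, blk_mul, star_zero, star_zero, rankOne_zero_left, Adj.zero_apply, star_zero,
      zero_act, mul_zero, mul_zero, zero_add, zero_add, zero_add]
  have h2 : star (blk (0 : B) (0 : E) 0 1) * blk 0 0 0 1 = blk 0 0 0 1 := by
    rw [blk_star, blk_mul, star_zero, star_one, rankOne_zero_left, rinner_zero_left,
      Adj.one_apply, zero_act, star_zero, zero_act, mul_zero, mul_one, zero_add, zero_add,
      zero_add]
  rw [h2, Finset.sum_congr rfl fun l _ => h1 l, ← map_sum]
  change _ = blk _ _ _ _ + _
  rw [blk_add, add_zero, add_zero, zero_add]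

theorem tendsto_blk_unit_mul (hE : IsFull B E) {α : Type*} {l : Filter α} {q : α → B}
    (hqs : ∀ i, star (q i) = q i) (hq : ∀ i, ‖q i‖ ≤ 1)
    (h : ∀ v : E, Tendsto (fun i => v <• q i) l (𝓝 v)) (a : Linking B E) :
    Tendsto (fun i => blk (q i) 0 0 1 * a) l (𝓝 a) := by
  have hqb : ∀ b, Tendsto (fun i => q i * b) l (𝓝 b) := fun b => by
    simpa only [star_mul, hqs, star_star] using (tendsto_of_isFull hE hq h (star b)).star
  obtain ⟨b, x, y, t, rfl⟩ := blk_surjective a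
  have e (i : α) : blk (q i) 0 0 1 * blk b x y t = blk (q i * b) x (y <• q i) t := by
    rw [blk_mul, hqs, rankOne_zero_left, zero_act, rinner_zero_left, map_zero, one_mul,
      Adj.one_apply, zero_add, zero_add, add_zero, add_zero]
  simp only [e]
  exact tendsto_blk x t (hqb b) (h y)

end LinkingAlgebra

/-! ### From a `τ`-map to a CP-H-extension -/

section Extension

variable {B C : Type*} {E F : Type*}
  [NonUnitalCStarAlgebra B] [PartialOrder B] [StarOrderedRing B]
  [NonUnitalCStarAlgebra C] [PartialOrder C] [StarOrderedRing C]
  [NormedAddCommGroup E] [NormedSpace ℂ E] [CompleteSpace E]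
  [SMul Bᵐᵒᵖ E] [CStarModule Bᵐᵒᵖ E]
  [NormedAddCommGroup F] [NormedSpace ℂ F] [CompleteSpace F]
  [SMul Cᵐᵒᵖ F] [CStarModule Cᵐᵒᵖ F]
  {T : E →ₗ[ℂ] F}

/-- The blocks of an element are unique, so any choice of them gives the same well-defined map. The
second `T` enters through `y*`, so the two conjugate-linearities cancel. -/
theorem exists_linking_map (τ : B →ₗ[ℂ] C) (T : E →ₗ[ℂ] F)
    (ϑ : Adj B E →ₗ[ℂ] Adj C (Gen C T)) :
    ∃ S : Linking B E →ₗ[ℂ] Linking C (Gen C T), ∀ b x y t,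
      S (blk b x y t) = blk (τ b) (Gen.mk C T x) (Gen.mk C T y) (ϑ t) := by
  choose b x y t h using blk_surjective (B := B) (E := E)
  have key : ∀ b' x' y' t', blk (τ (b (blk b' x' y' t'))) (Gen.mk C T (x (blk b' x' y' t')))
      (Gen.mk C T (y (blk b' x' y' t'))) (ϑ (t (blk b' x' y' t'))) =
      blk (τ b') (Gen.mk C T x') (Gen.mk C T y') (ϑ t') := fun b' x' y' t' => by
    obtain ⟨h1, h2, h3, h4⟩ := blk_injective (h (blk b' x' y' t'))
    rw [← h1, ← h2, ← h3, ← h4]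
  refine ⟨{
    toFun := fun a => blk (τ (b a)) (Gen.mk C T (x a)) (Gen.mk C T (y a)) (ϑ (t a))
    map_add' := fun a a' => ?_
    map_smul' := fun r a => ?_ }, key⟩
  · obtain ⟨b₁, x₁, y₁, t₁, rfl⟩ := blk_surjective a
    obtain ⟨b₂, x₂, y₂, t₂, rfl⟩ := blk_surjective a'
    rw [blk_add, key, key, key, blk_add]
    simp only [← Gen.mkₗ_apply, map_add]
  · obtain ⟨b₁, x₁, y₁, t₁, rfl⟩ := blk_surjective a
    rw [blk_smul, key, key, RingHom.id_apply, blk_smul]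
    simp only [← Gen.mkₗ_apply, map_smul]

/-- Linear maps on the linking algebra that are multiplicative on the second row in the sense of
`S(r* r') = S(r)* S(r')` are completely positive. -/
theorem exists_cp_of_rows (hE : IsFull B E) {D : Type*} [NonUnitalCStarAlgebra D] [PartialOrder D]
    [StarOrderedRing D] (S : Linking B E →ₗ[ℂ] D) (hcont : Continuous S)
    (hrow : ∀ x x' t t', S (star (blk 0 x 0 t) * blk 0 x' 0 t') =
      star (S (blk 0 x 0 t)) * S (blk 0 x' 0 t')) :
    ∃ S' : Linking B E →CP D, ∀ a, S' a = S a := by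
  classical
  refine ⟨cpOfGram S fun n a => ?_, fun _ => rfl⟩
  obtain ⟨w, hw1, hw⟩ := exists_column_net B E
  -- Inserting `diag(q, 1)` between `a_k*` and `a_k'` splits the product into terms `(r a_k)* (r
  -- a_k')` with `r` a second row, on which `S` is multiplicative.
  have hlim : ∀ k k', Tendsto (fun i => S (star (a k) *
      (blk (∑ l, rinner B (w i l) (w i l)) 0 0 1 * a k'))) atTop
      (𝓝 (S (star (a k) * a k'))) := fun k k' =>
    (hcont.tendsto _).comp (Tendsto.const_mul _ (tendsto_blk_unit_mul hE
      (fun i => by simp only [star_sum, star_rinner]) hw1 hw _))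
  refine nonneg_of_tendsto_entries (l := atTop) (M := fun i =>
    ∑ l, CStarMatrix.ofMatrix (fun k k' =>
        star (S (blk 0 (w i l) 0 0 * a k)) * S (blk 0 (w i l) 0 0 * a k')) +
      CStarMatrix.ofMatrix (fun k k' => star (S (blk 0 0 0 1 * a k)) * S (blk 0 0 0 1 * a k')))
    (fun k k' => ?_)
    fun i => add_nonneg (Finset.sum_nonneg fun l _ => rowGram_nonneg _) (rowGram_nonneg _)
  refine (hlim k k').congr fun i => ?_
  have hterm : ∀ x t, S (star (a k) * (star (blk 0 x 0 t) * blk 0 x 0 t * a k')) =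
      star (S (blk 0 x 0 t * a k)) * S (blk 0 x 0 t * a k') := fun x t => by
    obtain ⟨x₁, t₁, e₁⟩ := exists_row_eq_mul x t (a k)
    obtain ⟨x₂, t₂, e₂⟩ := exists_row_eq_mul x t (a k')
    rw [e₁, e₂, ← hrow, ← e₁, ← e₂, star_mul, mul_assoc, mul_assoc]
  rw [blk_unit_eq_sum, add_mul, mul_add, map_add, hterm, Finset.sum_mul, Finset.mul_sum, map_sum,
    Finset.sum_congr rfl fun l _ => hterm (w i l) 0, CStarMatrix.add_apply]
  erw [Finset.sum_apply, Finset.sum_apply]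
  rfl

theorem Gen.mk_zero : Gen.mk C T (0 : E) = 0 := map_zero (Gen.mkₗ C T)

theorem IsTauMap.isCPHExtendable (hE : IsFull B E) {τ : B →CP C} (h : IsTauMap τ T) :
    IsCPHExtendable B C T := by
  obtain ⟨ϑ, hmk⟩ : ∃ ϑ : Adj B E →⋆ₙₐ[ℂ] Adj C (Gen C T), ∀ a x,
      (ϑ a).1 (Gen.mk C T x) = Gen.mk C T (a.1 x) :=
    ⟨h.isAdjointCompatible.rep, h.isAdjointCompatible.rep_mk⟩
  obtain ⟨S, hS⟩ := exists_linking_map (τ : B →ₗ[ℂ] C) T (ϑ : Adj B E →ₗ[ℂ] Adj C (Gen C T))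
  replace hS : ∀ b x y t, S (blk b x y t) = blk (τ b) (Gen.mk C T x) (Gen.mk C T y) (ϑ t) := hS
  -- The `B`-corner uses the `τ`-map identity; the off-diagonal corners use `ϑ(a) T x = T (a x)`.
  have hrow : ∀ x x' t t', S (star (blk 0 x 0 t) * blk 0 x' 0 t') =
      star (S (blk 0 x 0 t)) * S (blk 0 x' 0 t') := fun x x' t t' => by
    rw [blk_star, blk_mul, hS, hS, hS, blk_star, blk_mul, Gen.mk_zero, map_zero τ]
    simp only [rankOne_zero_left, zero_act, star_zero, zero_add, mul_zero, map_mul,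
      map_star, ← hmk, ← h x x', Gen.rinner_mk]
  have hcont : Continuous S := by
    obtain ⟨K, hK0, hK⟩ := CompletelyPositiveMap.exists_norm_apply_le τ
    have hT : ∀ x, ‖Gen.mk C T x‖ ≤ √K * ‖x‖ := fun x => by
      refine abs_le_of_sq_le_sq' ?_ (by positivity) |>.2
      rw [mul_pow, Real.sq_sqrt hK0, norm_sq_eq (B := C), norm_sq_eq (B := B), Gen.rinner_mk, h]
      exact hK _
    refine AddMonoidHomClass.continuous_of_bound S ((K + √K) + (√K + 1)) fun a => ?_
    obtain ⟨b, x, y, t, rfl⟩ := blk_surjective a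
    obtain ⟨h1, h2, h3, h4⟩ := norm_blk_ge b x y t
    rw [hS]
    refine (norm_blk_le _ _ _ _).trans ?_
    rw [add_mul, add_mul, add_mul, one_mul]
    exact add_le_add
      (add_le_add ((hK b).trans (by gcongr)) ((hT y).trans (by gcongr)))
      (add_le_add ((hT x).trans (by gcongr)) ((NonUnitalStarAlgHom.norm_apply_le ϑ t).trans h4))
  obtain ⟨S', hS'⟩ := exists_cp_of_rows hE S hcont hrow
  exact ⟨S', τ, ϑ, fun b x y t => (hS' _).trans (hS b x y t)⟩

end Extension

/-! ### What positivity of a CP-H-extension forces on `T` -/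

theorem eq_zero_of_forall_le {A : Type*} [NonUnitalCStarAlgebra A] [PartialOrder A]
    [StarOrderedRing A] {a d : A} (ha : 0 ≤ a)
    (h : ∀ r : ℝ, 0 < r → (r : ℂ) • a ≤ d) : a = 0 := by
  rw [← norm_le_zero_iff]
  refine le_of_forall_pos_le_add fun ε hε => ?_
  -- For this `r`, the inequality `r ‖a‖ ≤ ‖d‖` gives `‖a‖ ≤ ε`; the added `1` keeps `r` positive
  -- when `d = 0`.
  have hr : 0 < (‖d‖ + 1) / ε := by positivity
  have h1 := CStarAlgebra.norm_le_norm_of_nonneg_of_le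
    (a := (((‖d‖ + 1) / ε : ℝ) : ℂ) • a) (by
      rw [Complex.coe_smul]; exact smul_nonneg hr.le ha) (h _ hr)
  rw [norm_smul, Complex.norm_real, Real.norm_of_nonneg hr.le, div_mul_eq_mul_div,
    div_le_iff₀ hε] at h1
  have h2 := norm_nonneg a
  have h3 := norm_nonneg d
  nlinarith

section Extension

variable {B C : Type*} {E F : Type*}
  [NonUnitalCStarAlgebra B] [PartialOrder B] [StarOrderedRing B]
  [NonUnitalCStarAlgebra C] [PartialOrder C] [StarOrderedRing C]
  [NormedAddCommGroup E] [NormedSpace ℂ E] [CompleteSpace E]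
  [SMul Bᵐᵒᵖ E] [CStarModule Bᵐᵒᵖ E]
  [NormedAddCommGroup F] [NormedSpace ℂ F] [CompleteSpace F]
  [SMul Cᵐᵒᵖ F] [CStarModule Cᵐᵒᵖ F]
  {T : E →ₗ[ℂ] F}

/-- The positivity of a block-wise completely positive map, tested on the elements
`t₀, t₁, x` of the second row of the linking algebra. -/
theorem blockwise_form_nonneg {S : Linking B E →CP Linking C (Gen C T)} {τ : B →CP C}
    {ϑ : Adj B E →⋆ₙₐ[ℂ] Adj C (Gen C T)}
    (hS : ∀ (b : B) (x y : E) (t : Adj B E),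
      S (blk b x y t) = blk (τ b) (Gen.mk C T x) (Gen.mk C T y) (ϑ t))
    (t₀ t₁ : Adj B E) (x : E) (z₀ z₁ : Gen C T) (c : C) :
    0 ≤ rinner C ((ϑ t₀).1 z₀ + (ϑ t₁).1 z₁) ((ϑ t₀).1 z₀ + (ϑ t₁).1 z₁) +
      (rinner C z₀ (Gen.mk C T ((star t₀).1 x)) + rinner C z₁ (Gen.mk C T ((star t₁).1 x))) * c +
      star c * (rinner C (Gen.mk C T ((star t₀).1 x)) z₀ +
        rinner C (Gen.mk C T ((star t₁).1 x)) z₁) +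
      star c * τ (rinner B x x) * c := by
  have a1 (s t : Adj B E) : S (star (blk 0 0 0 s) * blk 0 0 0 t) =
      blk 0 0 0 (star (ϑ s) * ϑ t) := by
    rw [blk_star, blk_mul, hS]
    simp only [zero_act, rinner_zero_left, rankOne_zero_left, map_zero, Gen.mk_zero, star_zero,
      mul_zero, zero_add, map_mul, map_star]
  have a2 (s : Adj B E) : S (star (blk 0 0 0 s) * blk 0 x 0 0) =
      blk 0 (Gen.mk C T ((star s).1 x)) 0 0 := by
    rw [blk_star, blk_mul, hS]
    simp only [zero_act, rinner_zero_left, rankOne_zero_left, map_zero, Gen.mk_zero, star_zero,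
      mul_zero, zero_add]
  have a3 (s : Adj B E) : S (star (blk 0 x 0 0) * blk 0 0 0 s) =
      blk 0 0 (Gen.mk C T ((star s).1 x)) 0 := by
    rw [blk_star, blk_mul, hS]
    simp only [zero_act, rinner_zero_right, rankOne_zero_left, map_zero, Gen.mk_zero, star_zero,
      zero_mul, zero_add]
  have a4 : S (star (blk 0 x 0 0) * blk 0 x 0 0) = blk (τ (rinner B x x)) 0 0 0 := by
    rw [blk_star, blk_mul, hS]
    simp only [zero_act, rankOne_zero_left, Gen.mk_zero, star_zero, map_zero, Adj.zero_apply,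
      zero_mul, zero_add]
  have a5 (s t : Adj B E) (z w : Gen C T) :
      rinner C z ((star (ϑ s) * ϑ t).1 w) = rinner C ((ϑ s).1 z) ((ϑ t).1 w) :=
    (Adj.rinner_apply_left _ _ _).symm
  obtain ⟨a, ha0, ha1, ha2⟩ : ∃ a : Fin 3 → Linking B E,
      a 0 = blk 0 0 0 t₀ ∧ a 1 = blk 0 0 0 t₁ ∧ a 2 = blk 0 x 0 0 :=
    ⟨![blk 0 0 0 t₀, blk 0 0 0 t₁, blk 0 x 0 0], rfl, rfl, rfl⟩
  -- Each test column lives in the summand on which the corresponding row of block images acts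
  -- nontrivially.
  obtain ⟨v, hv0, hv1, hv2⟩ : ∃ v : Fin 3 → Col C (Gen C T),
      v 0 = col 0 z₀ ∧ v 1 = col 0 z₁ ∧ v 2 = col c 0 :=
    ⟨![col 0 z₀, col 0 z₁, col c 0], rfl, rfl, rfl⟩
  have h := quadratic_form_nonneg (S.map_cstarMatrix_nonneg _ (rowGram_nonneg a)) v
  change 0 ≤ ∑ i, ∑ j, rinner C (v i) ((S (star (a i) * a j)).1.1 (v j)) at h
  convert h using 1
  simp only [Fin.sum_univ_three, ha0, ha1, ha2, hv0, hv1, hv2, a1, a2, a3, a4, blk_apply,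
    rinner_col, a5, rinner_zero_left, rinner_zero_right, rinner_add_left, rinner_add_right,
    rinner_act_right, star_zero, zero_mul, mul_zero, zero_add, add_zero, act_zero,
    Adj.zero_apply]
  noncomm_ring

variable {S : Linking B E →CP Linking C (Gen C T)} {τ : B →CP C}
  {ϑ : Adj B E →⋆ₙₐ[ℂ] Adj C (Gen C T)}

/-- The defect `D = T (t x) - ϑ(t) T x` appears linearly in a positive form whose quadratic term in
`z` has been cancelled. Scaling `z` then forces `D = 0`. Unitality of `ϑ` is not needed. -/
theorem rep_mk_of_blockwise
    (hS : ∀ (b : B) (x y : E) (t : Adj B E),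
      S (blk b x y t) = blk (τ b) (Gen.mk C T x) (Gen.mk C T y) (ϑ t))
    (t : Adj B E) (x : E) : (ϑ t).1 (Gen.mk C T x) = Gen.mk C T (t.1 x) := by
  symm
  rw [← sub_eq_zero]
  set D := Gen.mk C T (t.1 x) - (ϑ t).1 (Gen.mk C T x) with hD
  refine rinner_self_eq_zero (B := C) ?_
  set e := rinner C D D with he
  have hes : star e = e := star_rinner _ _
  have key (z : Gen C T) (c : C) : 0 ≤ rinner C z D * c + star c * rinner C D z +
      star c * τ (rinner B x x) * c := by
    -- The vectors are chosen so that `ϑ(t*) z₀ + ϑ(1) z₁ = 0`, using only `ϑ(1) ϑ(t*) = ϑ(t*)`.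
    have h := blockwise_form_nonneg hS (star t) 1 x z (-(ϑ (star t)).1 z) c
    have h0 : (ϑ (star t)).1 z + (ϑ 1).1 (-(ϑ (star t)).1 z) = 0 := by
      have : (ϑ 1).1 ((ϑ (star t)).1 z) = (ϑ (star t)).1 z := by
        change (ϑ 1 * ϑ (star t)).1 z = _
        rw [← map_mul, one_mul]
      rw [map_neg, this, add_neg_cancel]
    rw [h0, rinner_zero_left, zero_add, star_star, star_one, Adj.one_apply, rinner_neg_left,
      rinner_neg_right, map_star, ← Adj.rinner_apply_right, ← Adj.rinner_apply_left,
      ← sub_eq_add_neg, ← sub_eq_add_neg, ← rinner_sub_right, ← rinner_sub_left] at h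
    exact h
  rw [← CStarRing.star_mul_self_eq_zero_iff]
  refine eq_zero_of_forall_le (d := star e * τ (rinner B x x) * e) (star_mul_self_nonneg e)
    fun r hr => ?_
  -- Each of the two cross terms contributes `-(r / 2) e²`, so `r e² ≤ e τ(⟨x, x⟩) e` for every `r >
  -- 0`.
  have h := key (((-(r / 2) : ℝ) : ℂ) • D) e
  rw [rinner_smul_left, rinner_smul_right, ← he] at h
  rw [← sub_nonneg]
  convert h using 1
  have e1 : star ((-(r / 2) : ℝ) : ℂ) = ((-(r / 2) : ℝ) : ℂ) := Complex.conj_ofReal _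
  rw [e1, hes, smul_mul_assoc, mul_smul_comm, ← add_smul, ← Complex.ofReal_add, sub_eq_neg_add,
    ← neg_smul, ← Complex.ofReal_neg]
  congr 4
  ring

/-- Completing the square: `z = -T(x) c` minimizes the form. The result is an inequality only, since
the corner `τ` may be larger than the map belonging to `T`. -/
theorem conj_rinner_le_of_blockwise
    (hS : ∀ (b : B) (x y : E) (t : Adj B E),
      S (blk b x y t) = blk (τ b) (Gen.mk C T x) (Gen.mk C T y) (ϑ t))
    (x : E) (c : C) : star c * rinner C (T x) (T x) * c ≤ star c * τ (rinner B x x) * c := by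
  have h := blockwise_form_nonneg hS 1 0 x (-(Gen.mk C T x <• c)) 0 c
  have h1 : (ϑ 1).1 (-(Gen.mk C T x <• c)) + (ϑ 0).1 0 = -(Gen.mk C T x <• c) := by
    rw [map_neg, Adj.map_act, rep_mk_of_blockwise hS, Adj.one_apply, map_zero ϑ, Adj.zero_apply,
      add_zero]
  rw [h1, star_one, Adj.one_apply, rinner_zero_left, rinner_zero_right, add_zero, add_zero] at h
  rw [← sub_nonneg]
  convert h using 1
  simp only [rinner_act_left, rinner_act_right, rinner_neg_left, rinner_neg_right, Gen.rinner_mk]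
  noncomm_ring

theorem IsCPHExtendable.isAdjointCompatible (h : IsCPHExtendable B C T) :
    IsAdjointCompatible B C T := by
  obtain ⟨S, τ, ϑ, hS⟩ := h
  intro a x y
  rw [← Gen.rinner_mk, ← rep_mk_of_blockwise hS, Adj.rinner_apply_right, ← map_star,
    rep_mk_of_blockwise hS, Gen.rinner_mk]

theorem IsCPHExtendable.isColumnBounded (h : IsCPHExtendable B C T) :
    IsColumnBounded B C T := by
  obtain ⟨S, τ, ϑ, hS⟩ := h
  obtain ⟨K, hK0, hK⟩ := CompletelyPositiveMap.exists_norm_apply_le τ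
  refine ⟨K, hK0, fun n w => ?_⟩
  set G := ∑ i, rinner C (T (w i)) (T (w i)) with hG
  have hG0 : 0 ≤ G := Finset.sum_nonneg fun i _ => rinner_self_nonneg _
  have hGs : star G = G := hG0.isSelfAdjoint.star_eq
  -- Domination is known only after compression, so compress by `G` itself; the C⋆-identity `‖G‖⁴ =
  -- ‖G⁴‖` then cancels the extra factors.
  have h1 : star G * G * G ≤ star G * τ (∑ i, rinner B (w i) (w i)) * G := by
    have h2 := Finset.sum_le_sum (s := Finset.univ) fun i _ =>
      conj_rinner_le_of_blockwise hS (w i) G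
    rwa [← Finset.sum_mul, ← Finset.mul_sum, ← hG, ← Finset.sum_mul, ← Finset.mul_sum,
      ← map_sum] at h2
  have h3 := CStarAlgebra.norm_le_norm_of_nonneg_of_le (star_left_conjugate_nonneg hG0 G) h1
  have h4 : ‖G‖ ^ 4 ≤ ‖star G * G * G‖ * ‖G‖ := by
    have e1 : ‖G * G‖ = ‖G‖ * ‖G‖ := by
      nth_rw 1 [← hGs]; exact CStarRing.norm_star_mul_self
    have e2 : ‖star (G * G) * (G * G)‖ = ‖G * G‖ * ‖G * G‖ := CStarRing.norm_star_mul_self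
    rw [star_mul, hGs, e1] at e2
    calc ‖G‖ ^ 4 = ‖G * G * (G * G)‖ := by rw [e2]; ring
      _ ≤ ‖star G * G * G‖ * ‖G‖ := by rw [hGs, ← mul_assoc]; exact norm_mul_le _ _
  have h5 : ‖star G * τ (∑ i, rinner B (w i) (w i)) * G‖ ≤
      ‖G‖ * ‖τ (∑ i, rinner B (w i) (w i))‖ * ‖G‖ := by
    refine (norm_mul_le _ _).trans ?_
    gcongr
    exact (norm_mul_le _ _).trans_eq (by rw [norm_star])
  refine le_trans ?_ (hK _)
  rcases (norm_nonneg G).eq_or_lt with h0 | h0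
  · rw [← h0]; exact norm_nonneg _
  · refine le_of_mul_le_mul_left ?_ (pow_pos h0 3)
    calc ‖G‖ ^ 3 * ‖G‖ = ‖G‖ ^ 4 := by ring
      _ ≤ ‖G‖ * ‖τ (∑ i, rinner B (w i) (w i))‖ * ‖G‖ * ‖G‖ :=
        h4.trans (by gcongr; exact h3.trans h5)
      _ = _ := by ring

end Extension

end HilbMod

/-! ### The implications 1 ↔ 2 and 1 → 3 → 4 → 1 -/

open HilbMod in
theorem mainTheorem1 {B C E F : Type*}
    [NonUnitalCStarAlgebra B] [PartialOrder B] [StarOrderedRing B]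
    [NonUnitalCStarAlgebra C] [PartialOrder C] [StarOrderedRing C]
    [NormedAddCommGroup E] [NormedSpace ℂ E] [CompleteSpace E]
    [SMul Bᵐᵒᵖ E] [CStarModule Bᵐᵒᵖ E]
    [NormedAddCommGroup F] [NormedSpace ℂ F] [CompleteSpace F]
    [SMul Cᵐᵒᵖ F] [CStarModule Cᵐᵒᵖ F]
    (hE : IsFull B E) (T : E →ₗ[ℂ] F) :
    List.TFAE
      [∃ τ : B →CP C, IsTauMap τ T,
        IsCPHExtendable B C T,
        IsCompletelyBounded B C T ∧ IsLeftLinearizable B C T,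
        IsCompletelyBounded B C T ∧ IsQuaternary B C T] ∧
    ∀ τ τ' : B →CP C, IsTauMap τ T → IsTauMap τ' T → τ = τ' := by
  refine ⟨?_, fun τ τ' h h' => h.unique hE h'⟩
  tfae_have 1 → 2 := fun ⟨τ, h⟩ => h.isCPHExtendable hE
  tfae_have 2 → 1 := fun h => exists_isTauMap hE h.isAdjointCompatible h.isColumnBounded
  tfae_have 1 → 3 := fun ⟨τ, h⟩ =>
    ⟨h.isCompletelyBounded, h.isAdjointCompatible.isLeftLinearizable⟩
  tfae_have 3 → 4 := fun ⟨h, h'⟩ => ⟨h, h'.isAdjointCompatible.isQuaternary⟩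
  tfae_have 4 → 1 := fun ⟨h, h'⟩ =>
    exists_isTauMap hE (h'.isAdjointCompatible h.isColumnBounded.continuous) h.isColumnBounded
  tfae_finish
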